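/- All vector spaces and algebras are over $\mathbb{C}$; a $\mathbb{Z}_2$-graded vector space is $V=V_0\oplus V_1$, and $|v|$ is the degree of a homogeneous $v$. Let $P_B$ be the parabosonic algebra in countably many degrees of freedom: the unital associative algebra generated by $B_i^{\pm}$, $i=1,2,\dots$, with relations $$[\{B_i^{\xi},B_j^{\eta}\},B_k^{\epsilon}]=(\epsilon-\eta)\delta_{jk}B_i^{\xi}+(\epsilon-\xi)\delta_{ik}B_j^{\eta}\qquad(\xi,\eta,\epsilon=\pm1),$$ and let $B$ be the bosonic algebra, generated by $b_i^{\pm}$ with $[b_i^-,b_j^+]=\delta_{ij}$, $[b_i^-,b_j^-]=[b_i^+,b_j^+]=0$. Both are $\mathbb{Z}_2$-graded with odd generators, and $\phi:P_B\to B$, $B_i^\pm\mapsto b_i^\pm$, is a homomorphism. The braided tensor product $A\,\underline{\otimes}\,A'$ of superalgebras has product $(a\otimes b)(c\otimes d)=(-1)^{|b||c|}ac\otimes bd$, and it acts on the tensor product $V\otimes W$ of a graded $A$-module $V$ and a graded $A'$-module $W$ by $(a\otimes b)(v\otimes w)=(-1)^{|b||v|}av\otimes bw$. The super coproduct is the superalgebra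 homomorphism $\underline{\Delta}:P_B\to P_B\,\underline{\otimes}\,P_B$ with $\underline{\Delta}(B_i^\pm)=1\otimes B_i^\pm+B_i^\pm\otimes1$; put $\underline{\Delta}^{(0)}=\mathrm{Id}$, $\underline{\Delta}^{(1)}=\underline{\Delta}$ and $\underline{\Delta}^{(n)}=(\underline{\Delta}\otimes\mathrm{Id}\otimes\cdots\otimes\mathrm{Id})\circ\underline{\Delta}^{(n-1)}$. Let $F=F(1)$ be the bosonic Fock representation, viewed as a $P_B$-module through $\phi$: it has basis $|k\rangle=|k_1,k_2,\dots\rangle$ ($k$ a finitely supported sequence of non-negative integers), with $b_i^+|k\rangle=\sqrt{k_i+1}\,|\dots,k_i+1,\dots\rangle$ and $b_i^-|k\rangle=\sqrt{k_i}\,|\dots,k_i-1,\dots\rangle$; the vector $|k\rangle$ has degree $\sum_i k_i \bmod 2$, and $|0\rangle$ is the vacuum. For an integer $p\ge1$, the Fock-like representation $F(p)$ is a $P_B$-module with a (positive definite) inner product that is generated by a unit vector $\Omega$ such that $B_i^-\Omega=0$ and $B_i^-B_j^+\Omega=p\,\delta_{ij}\Omega$ for all $i,j$, such that every vector annihilated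 by all $B_i^-$ is a multiple of $\Omega$, and such that $(B_i^-)^\dagger=B_i^+$ for all $i$. **Statement.** Let $p\ge1$. Through $\underline{\Delta}^{(p-1)}:P_B\to P_B\,\underline{\otimes}\cdots\underline{\otimes}\,P_B$, the space $F\otimes\cdots\otimes F$ ($p$ factors) is a $\mathbb{Z}_2$-graded $P_B$-module. If $p\ge2$, it is reducible: it has a graded $P_B$-submodule other than $0$ and the whole module. For every $p\ge1$, the $P_B$-submodule generated by $|0\rangle\otimes\cdots\otimes|0\rangle$ is graded and irreducible, and it is exactly $F(p)$: with a suitable inner product and the vacuum $\Omega=|0\rangle\otimes\cdots\otimes|0\rangle$ it is a Fock-like representation $F(p)$, and every Fock-like representation $F(p)$ is isomorphic to it by a $P_B$-linear isometry that matches the vacua. -/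

import Mathlib

open scoped TensorProduct

noncomputable section

/-! ### `ℤ₂`-graded vector spaces

A `ℤ₂`-grading of a complex vector space `V` is given by its parity operator `γ` (the action of the
generator of `ℤ₂`), a linear involution; the component of degree `i` is the eigenspace of `γ` for
`(-1)^i`. -/

/-- The component of degree `i` for the parity operator `γ`: all `v` with `γ v = (-1)^i v`. -/
def parityPart {V : Type*} [AddCommGroup V] [Module ℂ V] (γ : V →ₗ[ℂ] V) (i : ZMod 2) :
    Submodule ℂ V :=
  LinearMap.ker (γ - (if i = 0 then (1 : ℂ) else -1) • LinearMap.id)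

theorem mem_parityPart_zero {V : Type*} [AddCommGroup V] [Module ℂ V] {γ : V →ₗ[ℂ] V} {v : V} :
    v ∈ parityPart γ 0 ↔ γ v = v := by
  simp [parityPart, sub_eq_zero]

theorem mem_parityPart_one {V : Type*} [AddCommGroup V] [Module ℂ V] {γ : V →ₗ[ℂ] V} {v : V} :
    v ∈ parityPart γ 1 ↔ γ v = -v := by
  simp [parityPart, add_eq_zero_iff_eq_neg]

/-- The projection `(1 + γ) / 2` onto the even part. -/
def evenProj {V : Type*} [AddCommGroup V] [Module ℂ V] (γ : V →ₗ[ℂ] V) : V →ₗ[ℂ] V :=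
  (2⁻¹ : ℂ) • (LinearMap.id + γ)

/-- The projection `(1 - γ) / 2` onto the odd part. -/
def oddProj {V : Type*} [AddCommGroup V] [Module ℂ V] (γ : V →ₗ[ℂ] V) : V →ₗ[ℂ] V :=
  (2⁻¹ : ℂ) • (LinearMap.id - γ)

theorem evenProj_add_oddProj {V : Type*} [AddCommGroup V] [Module ℂ V] (γ : V →ₗ[ℂ] V) (v : V) :
    evenProj γ v + oddProj γ v = v := by
  simp only [evenProj, oddProj, LinearMap.smul_apply, LinearMap.add_apply, LinearMap.sub_apply,
    LinearMap.id_apply]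
  module

theorem parityPart_isInternal {V : Type*} [AddCommGroup V] [Module ℂ V] (γ : V →ₗ[ℂ] V)
    (h : ∀ v, γ (γ v) = v) : DirectSum.IsInternal (parityPart γ) := by
  rw [DirectSum.isInternal_submodule_iff_isCompl (parityPart γ) (i := 0) (j := 1) (by decide)
    (by ext i; revert i; simp only [Set.mem_univ, true_iff]; decide)]
  constructor
  · rw [Submodule.disjoint_def]
    intro v h0 h1
    rw [mem_parityPart_zero] at h0
    rw [mem_parityPart_one, h0] at h1
    have h2 : (2 : ℂ) • v = 0 := by rw [two_smul]; nth_rw 1 [h1]; exact neg_add_cancel v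
    exact (smul_eq_zero.1 h2).resolve_left two_ne_zero
  · rw [codisjoint_iff, eq_top_iff]
    intro v _
    rw [← evenProj_add_oddProj γ v]
    refine Submodule.add_mem_sup ?_ ?_
    · rw [mem_parityPart_zero]
      simp [evenProj, h, add_comm]
    · rw [mem_parityPart_one]
      simp [oddProj, h, ← smul_neg]

/-! ### Superalgebras and their braided tensor product -/

/-- A complex superalgebra (`ℤ₂`-graded associative unital algebra). -/
structure SuperAlg where
  carrier : Type
  [ring : Ring carrier]
  [algebra : Algebra ℂ carrier]
  γ : carrier →ₐ[ℂ] carrier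
  γ_γ : ∀ a, γ (γ a) = a

namespace SuperAlg

instance : CoeSort SuperAlg Type := ⟨SuperAlg.carrier⟩

attribute [instance] SuperAlg.ring SuperAlg.algebra

/-- The homogeneous components of a superalgebra. -/
def grading (A : SuperAlg) : ZMod 2 → Submodule ℂ A := parityPart A.γ.toLinearMap

theorem mem_grading_zero {A : SuperAlg} {a : A} : a ∈ A.grading 0 ↔ A.γ a = a :=
  mem_parityPart_zero

theorem mem_grading_one {A : SuperAlg} {a : A} : a ∈ A.grading 1 ↔ A.γ a = -a :=
  mem_parityPart_one

instance (A : SuperAlg) : SetLike.GradedMonoid A.grading where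
  one_mem := by rw [mem_grading_zero, map_one]
  mul_mem := by
    intro i j a b ha hb
    fin_cases i <;> fin_cases j
    · exact mem_grading_zero.2
        (by rw [map_mul, mem_grading_zero.1 ha, mem_grading_zero.1 hb])
    · exact mem_grading_one.2
        (by rw [map_mul, mem_grading_zero.1 ha, mem_grading_one.1 hb, mul_neg])
    · exact mem_grading_one.2
        (by rw [map_mul, mem_grading_one.1 ha, mem_grading_zero.1 hb, neg_mul])
    · exact mem_grading_zero.2
        (by rw [map_mul, mem_grading_one.1 ha, mem_grading_one.1 hb, neg_mul_neg])

instance (A : SuperAlg) : GradedAlgebra A.grading where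
  toDecomposition := (parityPart_isInternal A.γ.toLinearMap A.γ_γ).chooseDecomposition

/-- A homomorphism of superalgebras: an algebra homomorphism that respects the gradings. -/
structure Hom (A B : SuperAlg) where
  toAlgHom : A →ₐ[ℂ] B
  map_γ : ∀ a, toAlgHom (A.γ a) = B.γ (toAlgHom a)

namespace Hom

/-- The identity homomorphism. -/
def id (A : SuperAlg) : Hom A A := ⟨AlgHom.id ℂ A, fun _ => rfl⟩

/-- Composition, `g.comp f = g ∘ f`. -/
def comp {A B C : SuperAlg} (g : Hom B C) (f : Hom A B) : Hom A C :=
  ⟨g.toAlgHom.comp f.toAlgHom, fun a => by simp [f.map_γ, g.map_γ]⟩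

theorem map_mem {A B : SuperAlg} (f : Hom A B) {i : ZMod 2} {a : A} (ha : a ∈ A.grading i) :
    f.toAlgHom a ∈ B.grading i := by
  fin_cases i
  · exact mem_grading_zero.2 (by rw [← f.map_γ, mem_grading_zero.1 ha])
  · exact mem_grading_one.2 (by rw [← f.map_γ, mem_grading_one.1 ha, map_neg])

end Hom

theorem tmul_supercomm {A B : SuperAlg} {i j : ZMod 2} {a : A} {b : B}
    (ha : a ∈ A.grading i) (hb : b ∈ B.grading j) :
    GradedTensorProduct.includeLeft A.grading B.grading a *
        GradedTensorProduct.includeRight A.grading B.grading b =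
      (-1 : ℤˣ) ^ (j * i) • (GradedTensorProduct.includeRight A.grading B.grading b *
        GradedTensorProduct.includeLeft A.grading B.grading a) := by
  have h := GradedTensorProduct.tmul_coe_mul_coe_tmul (R := ℂ) A.grading B.grading
    (1 : A) (⟨b, hb⟩ : B.grading j) (⟨a, ha⟩ : A.grading i) (1 : B)
  simp only [one_mul, mul_one] at h
  rw [GradedTensorProduct.includeLeft_apply, GradedTensorProduct.includeRight_apply, h,
    GradedTensorProduct.tmul_one_mul_one_tmul, smul_smul, Int.units_mul_self, one_smul]

/-- The map `f ⊗ g` between the algebras underlying braided tensor products. -/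
def tensorAlgHom {A A' B B' : SuperAlg} (f : Hom A A') (g : Hom B B') :
    (A.grading ᵍ⊗[ℂ] B.grading) →ₐ[ℂ] (A'.grading ᵍ⊗[ℂ] B'.grading) :=
  GradedTensorProduct.lift A.grading B.grading
    ((GradedTensorProduct.includeLeft A'.grading B'.grading).comp f.toAlgHom)
    ((GradedTensorProduct.includeRight A'.grading B'.grading).comp g.toAlgHom)
    (fun _ _ a b => tmul_supercomm (f.map_mem a.2) (g.map_mem b.2))

theorem tensorAlgHom_tmul {A A' B B' : SuperAlg} (f : Hom A A') (g : Hom B B') (a : A) (b : B) :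
    tensorAlgHom f g (a ᵍ⊗ₜ[ℂ] b) = f.toAlgHom a ᵍ⊗ₜ[ℂ] g.toAlgHom b := by
  exact GradedTensorProduct.tmul_one_mul_one_tmul A'.grading B'.grading _ _

/-- The parity operator as an endomorphism of the superalgebra. -/
def parityHom (A : SuperAlg) : Hom A A := ⟨A.γ, fun _ => rfl⟩

/-- The braided tensor product `A ⊗̲ B`, with `(a ⊗ b)(c ⊗ d) = (-1)^(|b||c|) ac ⊗ bd`; the parity
operator is `γ ⊗ γ`. -/
def tensor (A B : SuperAlg) : SuperAlg where
  carrier := A.grading ᵍ⊗[ℂ] B.grading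
  γ := tensorAlgHom A.parityHom B.parityHom
  γ_γ := by
    intro x
    have : (tensorAlgHom A.parityHom B.parityHom).comp (tensorAlgHom A.parityHom B.parityHom) =
        AlgHom.id ℂ _ := by
      ext a <;> simp [tensorAlgHom_tmul, parityHom, A.γ_γ, B.γ_γ]
    exact DFunLike.congr_fun this x

/-- The homomorphism `f ⊗ g : A ⊗̲ B → A' ⊗̲ B'`. -/
def Hom.tensor {A A' B B' : SuperAlg} (f : Hom A A') (g : Hom B B') :
    Hom (A.tensor B) (A'.tensor B') where
  toAlgHom := tensorAlgHom f g
  map_γ := by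
    intro x
    have : (tensorAlgHom f g).comp (tensorAlgHom A.parityHom B.parityHom) =
        (tensorAlgHom A'.parityHom B'.parityHom).comp (tensorAlgHom f g) := by
      ext a <;> simp [tensorAlgHom_tmul, parityHom, f.map_γ, g.map_γ]
    exact DFunLike.congr_fun this x

end SuperAlg

/-! ### Supermodules -/

/-- A braided (`ℤ₂`-graded) module over the superalgebra `A`: a complex vector space with an
`A`-action `ρ` and a parity operator `γ` such that the action respects the gradings. -/
structure SuperMod (A : SuperAlg) where
  carrier : Type
  [addCommGroup : AddCommGroup carrier]
  [moduleC : Module ℂ carrier]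
  ρ : A →ₐ[ℂ] Module.End ℂ carrier
  γ : carrier →ₗ[ℂ] carrier
  γ_γ : ∀ v, γ (γ v) = v
  γ_ρ : ∀ a v, γ (ρ a v) = ρ (A.γ a) (γ v)

namespace SuperMod

instance (A : SuperAlg) : CoeSort (SuperMod A) Type := ⟨SuperMod.carrier⟩

attribute [instance] SuperMod.addCommGroup SuperMod.moduleC

instance {A : SuperAlg} (V : SuperMod A) : Module A V := Module.compHom V V.ρ.toRingHom

theorem smul_def {A : SuperAlg} (V : SuperMod A) (a : A) (v : V) : a • v = V.ρ a v := rfl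

instance {A : SuperAlg} (V : SuperMod A) : IsScalarTower ℂ A V where
  smul_assoc c a v := by simp only [smul_def, map_smul, LinearMap.smul_apply]

/-- The homogeneous components of a supermodule. -/
def grading {A : SuperAlg} (V : SuperMod A) : ZMod 2 → Submodule ℂ V := parityPart V.γ

/-- An `A`-submodule is a graded submodule if each of its elements is the sum of an even and an odd
element of the submodule. -/
def IsGradedSubmodule {A : SuperAlg} (V : SuperMod A) (N : Submodule A V) : Prop :=
  ∀ v ∈ N, ∃ v₀ ∈ N, ∃ v₁ ∈ N, v₀ ∈ V.grading 0 ∧ v₁ ∈ V.grading 1 ∧ v = v₀ + v₁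

/-- Pullback of a supermodule along a homomorphism of superalgebras. -/
def restrict {A B : SuperAlg} (f : SuperAlg.Hom A B) (V : SuperMod B) : SuperMod A where
  carrier := V
  ρ := V.ρ.comp f.toAlgHom
  γ := V.γ
  γ_γ := V.γ_γ
  γ_ρ a v := by simp [V.γ_ρ, f.map_γ]

/-- The action of the left factor on `V ⊗ W`: `a (v ⊗ w) = a v ⊗ w`. -/
def leftAction {A : SuperAlg} (V : SuperMod A) (W : Type) [AddCommGroup W] [Module ℂ W] :
    A →ₐ[ℂ] Module.End ℂ (V ⊗[ℂ] W) :=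
  AlgHom.ofLinearMap ((LinearMap.rTensorHom W).comp V.ρ.toLinearMap)
    (by ext; simp) (by intro a b; ext; simp)

/-- The linear map underlying `rightAction`: on even `v` it is `v ⊗ w ↦ v ⊗ b w` and on odd `v` it
is `v ⊗ w ↦ v ⊗ (γ b) w`. -/
def rightActionLinear {A B : SuperAlg} (V : SuperMod A) (W : SuperMod B) :
    B →ₗ[ℂ] Module.End ℂ (V ⊗[ℂ] W) :=
  (TensorProduct.mapBilinear (RingHom.id ℂ) V W V W (evenProj V.γ)).comp W.ρ.toLinearMap +
    (TensorProduct.mapBilinear (RingHom.id ℂ) V W V W (oddProj V.γ)).comp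
      (W.ρ.toLinearMap.comp B.γ.toLinearMap)

theorem rightActionLinear_tmul {A B : SuperAlg} (V : SuperMod A) (W : SuperMod B) (b : B) (v : V)
    (w : W) : rightActionLinear V W b (v ⊗ₜ w) =
      evenProj V.γ v ⊗ₜ W.ρ b w + oddProj V.γ v ⊗ₜ W.ρ (B.γ b) w := by
  simp [rightActionLinear]

/-- The action of the right factor on `V ⊗ W`: `b (v ⊗ w) = (-1)^(|b||v|) v ⊗ b w`. -/
def rightAction {A B : SuperAlg} (V : SuperMod A) (W : SuperMod B) :
    B →ₐ[ℂ] Module.End ℂ (V ⊗[ℂ] W) :=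
  AlgHom.ofLinearMap (rightActionLinear V W)
    (by
      ext v w
      simp [rightActionLinear_tmul, ← TensorProduct.add_tmul, evenProj_add_oddProj])
    (by
      intro b c
      ext v w
      have h00 : evenProj V.γ (evenProj V.γ v) = evenProj V.γ v := by
        simp only [evenProj, LinearMap.smul_apply, LinearMap.add_apply, LinearMap.id_apply,
          map_smul, map_add, V.γ_γ]
        module
      have h01 : evenProj V.γ (oddProj V.γ v) = 0 := by
        simp only [evenProj, oddProj, LinearMap.smul_apply, LinearMap.add_apply,
          LinearMap.sub_apply, LinearMap.id_apply, map_smul, map_sub, V.γ_γ]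
        module
      have h10 : oddProj V.γ (evenProj V.γ v) = 0 := by
        simp only [evenProj, oddProj, LinearMap.smul_apply, LinearMap.add_apply,
          LinearMap.sub_apply, LinearMap.id_apply, map_smul, map_add, V.γ_γ]
        module
      have h11 : oddProj V.γ (oddProj V.γ v) = oddProj V.γ v := by
        simp only [oddProj, LinearMap.smul_apply, LinearMap.sub_apply, LinearMap.id_apply,
          map_smul, map_sub, V.γ_γ]
        module
      simp [rightActionLinear_tmul, h00, h01, h10, h11])

theorem rightAction_tmul {A B : SuperAlg} (V : SuperMod A) (W : SuperMod B) (b : B) (v : V)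
    (w : W) : rightAction V W b (v ⊗ₜ w) =
      evenProj V.γ v ⊗ₜ W.ρ b w + oddProj V.γ v ⊗ₜ W.ρ (B.γ b) w :=
  rightActionLinear_tmul V W b v w

theorem leftAction_tmul {A : SuperAlg} (V : SuperMod A) (W : Type) [AddCommGroup W] [Module ℂ W]
    (a : A) (v : V) (w : W) : leftAction V W a (v ⊗ₜ w) = V.ρ a v ⊗ₜ w := by
  simp [leftAction]

theorem action_supercomm {A B : SuperAlg} (V : SuperMod A) (W : SuperMod B) {i j : ZMod 2}
    {a : A} {b : B} (ha : a ∈ A.grading i) (hb : b ∈ B.grading j) :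
    leftAction V W a * rightAction V W b =
      (-1 : ℤˣ) ^ (j * i) • (rightAction V W b * leftAction V W a) := by
  have even0 (h : A.γ a = a) (v : V) : evenProj V.γ (V.ρ a v) = V.ρ a (evenProj V.γ v) := by
    simp [evenProj, V.γ_ρ, h]
  have odd0 (h : A.γ a = a) (v : V) : oddProj V.γ (V.ρ a v) = V.ρ a (oddProj V.γ v) := by
    simp [oddProj, V.γ_ρ, h]
  have even1 (h : A.γ a = -a) (v : V) : evenProj V.γ (V.ρ a v) = V.ρ a (oddProj V.γ v) := by
    simp [evenProj, oddProj, V.γ_ρ, h, sub_eq_add_neg]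
  have odd1 (h : A.γ a = -a) (v : V) : oddProj V.γ (V.ρ a v) = V.ρ a (evenProj V.γ v) := by
    simp [evenProj, oddProj, V.γ_ρ, h]
  have cases2 : ∀ k : ZMod 2, k = 0 ∨ k = 1 := by decide
  ext v w
  obtain rfl | rfl := cases2 i <;> obtain rfl | rfl := cases2 j
  · have h := SuperAlg.mem_grading_zero.1 ha
    have h' := SuperAlg.mem_grading_zero.1 hb
    simp [rightAction_tmul, leftAction_tmul, even0 h, odd0 h, h']
  · have h := SuperAlg.mem_grading_zero.1 ha
    have h' := SuperAlg.mem_grading_one.1 hb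
    simp [rightAction_tmul, leftAction_tmul, even0 h, odd0 h, h']
  · have h := SuperAlg.mem_grading_one.1 ha
    have h' := SuperAlg.mem_grading_zero.1 hb
    simp [rightAction_tmul, leftAction_tmul, even1 h, odd1 h, h', add_comm]
  · have h := SuperAlg.mem_grading_one.1 ha
    have h' := SuperAlg.mem_grading_one.1 hb
    simp [rightAction_tmul, leftAction_tmul, even1 h, odd1 h, h', TensorProduct.tmul_neg,
      add_comm]

/-- The action of `A ⊗̲ B` on `V ⊗ W`: `(a ⊗ b) (v ⊗ w) = (-1)^(|b||v|) a v ⊗ b w`. -/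
def tensorAction {A B : SuperAlg} (V : SuperMod A) (W : SuperMod B) :
    (A.grading ᵍ⊗[ℂ] B.grading) →ₐ[ℂ] Module.End ℂ (V ⊗[ℂ] W) :=
  GradedTensorProduct.lift A.grading B.grading (leftAction V W) (rightAction V W)
    (fun _ _ a b => action_supercomm V W a.2 b.2)

theorem tensorAction_tmul {A B : SuperAlg} (V : SuperMod A) (W : SuperMod B) (a : A) (b : B)
    (v : V) (w : W) : tensorAction V W (a ᵍ⊗ₜ[ℂ] b) (v ⊗ₜ w) =
      V.ρ a (evenProj V.γ v) ⊗ₜ W.ρ b w + V.ρ a (oddProj V.γ v) ⊗ₜ W.ρ (B.γ b) w := by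
  change leftAction V W a (rightAction V W b (v ⊗ₜ w)) = _
  rw [rightAction_tmul, map_add, leftAction_tmul, leftAction_tmul]

theorem tensorAction_parity {A B : SuperAlg} (V : SuperMod A) (W : SuperMod B)
    (x : A.grading ᵍ⊗[ℂ] B.grading) (y : V ⊗[ℂ] W) :
    TensorProduct.map V.γ W.γ (tensorAction V W x y) =
      tensorAction V W (SuperAlg.tensorAlgHom A.parityHom B.parityHom x)
        (TensorProduct.map V.γ W.γ y) := by
  have h : ∀ z : A ⊗[ℂ] B,
      TensorProduct.map V.γ W.γ
          (tensorAction V W (GradedTensorProduct.of ℂ A.grading B.grading z) y) =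
        tensorAction V W (SuperAlg.tensorAlgHom A.parityHom B.parityHom
          (GradedTensorProduct.of ℂ A.grading B.grading z)) (TensorProduct.map V.γ W.γ y) := by
    intro z
    induction z using TensorProduct.induction_on with
    | zero => simp
    | add z₁ z₂ h₁ h₂ => simp only [map_add, LinearMap.add_apply, h₁, h₂]
    | tmul a b =>
      rw [SuperAlg.tensorAlgHom_tmul]
      induction y using TensorProduct.induction_on with
      | zero => simp
      | add y₁ y₂ h₁ h₂ => simp only [map_add, h₁, h₂]
      | tmul v w =>
        simp only [TensorProduct.map_tmul, tensorAction_tmul, map_add, V.γ_ρ, W.γ_ρ,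
          SuperAlg.parityHom]
        have he : V.γ (evenProj V.γ v) = evenProj V.γ (V.γ v) := by simp [evenProj]
        have ho : V.γ (oddProj V.γ v) = oddProj V.γ (V.γ v) := by simp [oddProj]
        rw [he, ho]
  exact h ((GradedTensorProduct.of ℂ A.grading B.grading).symm x)

/-- The braided tensor product of an `A`-supermodule `V` and a `B`-supermodule `W`, a supermodule
over `A ⊗̲ B`: `(a ⊗ b) (v ⊗ w) = (-1)^(|b||v|) a v ⊗ b w`, with parity operator `γ ⊗ γ`. -/
def tensor {A B : SuperAlg} (V : SuperMod A) (W : SuperMod B) : SuperMod (A.tensor B) where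
  carrier := V ⊗[ℂ] W
  ρ := tensorAction V W
  γ := TensorProduct.map V.γ W.γ
  γ_γ := by
    intro x
    have : TensorProduct.map V.γ W.γ ∘ₗ TensorProduct.map V.γ W.γ = LinearMap.id := by
      ext v w; simp [V.γ_γ, W.γ_γ]
    exact DFunLike.congr_fun this x
  γ_ρ := tensorAction_parity V W

end SuperMod

/-! ### The bosonic and the parabosonic superalgebra

The generators `X_i^ξ` are indexed by a sign `ξ : ℤˣ` and a degree of freedom `i : ℕ` (countably
many degrees of freedom). -/

/-- The complex number `ξ = ±1`. -/
def sgn (ξ : ℤˣ) : ℂ := ((ξ : ℤ) : ℂ)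

/-- The Kronecker delta. -/
def delta (i j : ℕ) : ℂ := if i = j then 1 else 0

/-- The expression
`[{x_i^ξ, x_j^η}, x_k^ε] - (ε - η) δ_jk x_i^ξ - (ε - ξ) δ_ik x_j^η`. -/
def paraExpr {A : Type*} [Ring A] [Algebra ℂ A] (x : ℤˣ → ℕ → A) (ξ η ε : ℤˣ) (i j k : ℕ) : A :=
  ((x ξ i * x η j + x η j * x ξ i) * x ε k - x ε k * (x ξ i * x η j + x η j * x ξ i))
    - ((sgn ε - sgn η) * delta j k) • x ξ i - ((sgn ε - sgn ξ) * delta i k) • x η j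

/-- The generators of the free algebra. -/
def freeGen (ξ : ℤˣ) (i : ℕ) : FreeAlgebra ℂ (ℤˣ × ℕ) := FreeAlgebra.ι ℂ (ξ, i)

/-- The defining relations of the parabosonic algebra. -/
inductive ParaRel : FreeAlgebra ℂ (ℤˣ × ℕ) → FreeAlgebra ℂ (ℤˣ × ℕ) → Prop
  | mk (ξ η ε : ℤˣ) (i j k : ℕ) : ParaRel (paraExpr freeGen ξ η ε i j k) 0

/-- The defining relations of the bosonic algebra (canonical commutation relations). -/
inductive BoseRel : FreeAlgebra ℂ (ℤˣ × ℕ) → FreeAlgebra ℂ (ℤˣ × ℕ) → Prop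
  | ccr (i j : ℕ) : BoseRel
      (freeGen (-1) i * freeGen 1 j - freeGen 1 j * freeGen (-1) i) (delta i j • 1)
  | comm (ξ : ℤˣ) (i j : ℕ) : BoseRel (freeGen ξ i * freeGen ξ j - freeGen ξ j * freeGen ξ i) 0

theorem map_paraExpr {A B : Type*} [Ring A] [Algebra ℂ A] [Ring B] [Algebra ℂ B] (f : A →ₐ[ℂ] B)
    (x : ℤˣ → ℕ → A) (ξ η ε : ℤˣ) (i j k : ℕ) :
    f (paraExpr x ξ η ε i j k) = paraExpr (fun ξ i => f (x ξ i)) ξ η ε i j k := by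
  simp [paraExpr]

theorem paraExpr_neg {A : Type*} [Ring A] [Algebra ℂ A]
    (x : ℤˣ → ℕ → A) (ξ η ε : ℤˣ) (i j k : ℕ) :
    paraExpr (fun ξ i => -x ξ i) ξ η ε i j k = -paraExpr x ξ η ε i j k := by
  simp only [paraExpr, smul_neg]
  noncomm_ring

theorem paraExpr_add {A : Type*} [Ring A] [Algebra ℂ A]
    (x y : ℤˣ → ℕ → A) (h : ∀ ξ η i j, y ξ i * x η j = -(x η j * y ξ i))
    (ξ η ε : ℤˣ) (i j k : ℕ) :
    paraExpr (fun ξ i => x ξ i + y ξ i) ξ η ε i j k =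
      paraExpr x ξ η ε i j k + paraExpr y ξ η ε i j k := by
  have h1 : (x ξ i + y ξ i) * (x η j + y η j) + (x η j + y η j) * (x ξ i + y ξ i) =
      (x ξ i * x η j + x η j * x ξ i) + (y ξ i * y η j + y η j * y ξ i) := by
    simp only [mul_add, add_mul, h]
    abel
  have hx : (x ξ i * x η j + x η j * x ξ i) * y ε k = y ε k * (x ξ i * x η j + x η j * x ξ i) := by
    simp only [mul_add, add_mul, ← mul_assoc, h, neg_mul]
    simp only [mul_assoc, h, mul_neg, neg_neg]
  have hy : (y ξ i * y η j + y η j * y ξ i) * x ε k = x ε k * (y ξ i * y η j + y η j * y ξ i) := by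
    simp only [mul_add, add_mul, mul_assoc, h, mul_neg]
    simp only [← mul_assoc, h, neg_mul, neg_neg]
  simp only [paraExpr, h1, smul_add]
  simp only [mul_add _ (x ε k) (y ε k), add_mul (x ε k) (y ε k), hx, hy, add_mul (_ + _) (_ + _) _,
    mul_add _ (_ + _) (_ + _)]
  abel

/-- Bosonic generators satisfy the parabosonic relations. -/
theorem paraExpr_eq_zero_of_ccr {A : Type*} [Ring A] [Algebra ℂ A] (x : ℤˣ → ℕ → A)
    (h : ∀ i j, x (-1) i * x 1 j - x 1 j * x (-1) i = delta i j • (1 : A))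
    (h' : ∀ ξ i j, x ξ i * x ξ j - x ξ j * x ξ i = 0) (ξ η ε : ℤˣ) (i j k : ℕ) :
    paraExpr x ξ η ε i j k = 0 := by
  have hc : ∀ ξ ε i k, x ξ i * x ε k - x ε k * x ξ i =
      ((sgn ε - sgn ξ) / 2 * delta i k) • (1 : A) := by
    intro ξ ε i k
    obtain rfl | rfl := Int.units_eq_one_or ξ <;> obtain rfl | rfl := Int.units_eq_one_or ε
    · simp [h']
    · have := h k i
      rw [← neg_sub, this, ← neg_smul]
      congr 1
      by_cases hik : i = k
      · simp [sgn, delta, hik]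
        norm_num
      · simp [sgn, delta, hik, Ne.symm hik]
    · rw [h]
      congr 1
      simp only [sgn]
      norm_num
    · simp [h']
  have e1 := hc ξ ε i k
  have e2 := hc η ε j k
  have key : (x ξ i * x η j + x η j * x ξ i) * x ε k - x ε k * (x ξ i * x η j + x η j * x ξ i) =
      x ξ i * (x η j * x ε k - x ε k * x η j) + (x ξ i * x ε k - x ε k * x ξ i) * x η j +
      x η j * (x ξ i * x ε k - x ε k * x ξ i) + (x η j * x ε k - x ε k * x η j) * x ξ i := by
    noncomm_ring
  rw [paraExpr, key, e1, e2]
  simp only [mul_smul_comm, smul_mul_assoc, mul_one, one_mul]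
  module

/-- The parabosonic algebra as an algebra. -/
def ParaAlgebra : Type := RingQuot ParaRel

instance : Ring ParaAlgebra := inferInstanceAs (Ring (RingQuot ParaRel))

instance : Algebra ℂ ParaAlgebra := inferInstanceAs (Algebra ℂ (RingQuot ParaRel))

/-- The bosonic algebra as an algebra. -/
def BoseAlgebra : Type := RingQuot BoseRel

instance : Ring BoseAlgebra := inferInstanceAs (Ring (RingQuot BoseRel))

instance : Algebra ℂ BoseAlgebra := inferInstanceAs (Algebra ℂ (RingQuot BoseRel))

namespace ParaAlgebra

/-- The generator `B_i^ξ`. -/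
def gen (ξ : ℤˣ) (i : ℕ) : ParaAlgebra := RingQuot.mkAlgHom ℂ ParaRel (freeGen ξ i)

theorem paraExpr_gen (ξ η ε : ℤˣ) (i j k : ℕ) : paraExpr gen ξ η ε i j k = 0 := by
  have h := RingQuot.mkAlgHom_rel ℂ (ParaRel.mk ξ η ε i j k)
  rw [map_zero] at h
  exact (map_paraExpr (RingQuot.mkAlgHom ℂ ParaRel) freeGen ξ η ε i j k).symm.trans h

/-- The algebra homomorphism determined by the images of the generators. -/
def lift {A : Type*} [Ring A] [Algebra ℂ A] (x : ℤˣ → ℕ → A)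
    (h : ∀ ξ η ε i j k, paraExpr x ξ η ε i j k = 0) : ParaAlgebra →ₐ[ℂ] A :=
  RingQuot.liftAlgHom ℂ ⟨FreeAlgebra.lift ℂ (fun q : ℤˣ × ℕ => x q.1 q.2), by
    rintro _ _ ⟨ξ, η, ε, i, j, k⟩
    rw [map_paraExpr, map_zero]
    simpa [freeGen] using h ξ η ε i j k⟩

theorem lift_gen {A : Type*} [Ring A] [Algebra ℂ A] (x : ℤˣ → ℕ → A)
    (h : ∀ ξ η ε i j k, paraExpr x ξ η ε i j k = 0) (ξ : ℤˣ) (i : ℕ) :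
    lift x h (gen ξ i) = x ξ i := by
  refine (RingQuot.liftAlgHom_mkAlgHom_apply ℂ _ _ (freeGen ξ i)).trans ?_
  simp [freeGen]

theorem hom_ext {A : Type*} [Ring A] [Algebra ℂ A] {f g : ParaAlgebra →ₐ[ℂ] A}
    (h : ∀ ξ i, f (gen ξ i) = g (gen ξ i)) : f = g := by
  refine RingQuot.ringQuot_ext' ℂ f g (FreeAlgebra.hom_ext ?_)
  ext q
  exact h q.1 q.2

end ParaAlgebra

namespace BoseAlgebra

/-- The generator `b_i^ξ`. -/
def gen (ξ : ℤˣ) (i : ℕ) : BoseAlgebra := RingQuot.mkAlgHom ℂ BoseRel (freeGen ξ i)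

theorem gen_ccr (i j : ℕ) :
    gen (-1) i * gen 1 j - gen 1 j * gen (-1) i = delta i j • (1 : BoseAlgebra) := by
  have h := RingQuot.mkAlgHom_rel ℂ (BoseRel.ccr i j)
  simp only [map_sub, map_mul, map_smul, map_one] at h
  exact h

theorem gen_comm (ξ : ℤˣ) (i j : ℕ) : gen ξ i * gen ξ j - gen ξ j * gen ξ i = 0 := by
  have h := RingQuot.mkAlgHom_rel ℂ (BoseRel.comm ξ i j)
  simp only [map_sub, map_mul, map_zero] at h
  exact h

/-- The algebra homomorphism determined by the images of the generators. -/
def lift {A : Type*} [Ring A] [Algebra ℂ A] (x : ℤˣ → ℕ → A)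
    (h : ∀ i j, x (-1) i * x 1 j - x 1 j * x (-1) i = delta i j • (1 : A))
    (h' : ∀ ξ i j, x ξ i * x ξ j - x ξ j * x ξ i = 0) : BoseAlgebra →ₐ[ℂ] A :=
  RingQuot.liftAlgHom ℂ ⟨FreeAlgebra.lift ℂ (fun q : ℤˣ × ℕ => x q.1 q.2), by
    rintro _ _ (⟨i, j⟩ | ⟨ξ, i, j⟩)
    · simpa [freeGen] using h i j
    · simpa [freeGen] using h' ξ i j⟩

theorem lift_gen {A : Type*} [Ring A] [Algebra ℂ A] (x : ℤˣ → ℕ → A)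
    (h : ∀ i j, x (-1) i * x 1 j - x 1 j * x (-1) i = delta i j • (1 : A))
    (h' : ∀ ξ i j, x ξ i * x ξ j - x ξ j * x ξ i = 0) (ξ : ℤˣ) (i : ℕ) :
    lift x h h' (gen ξ i) = x ξ i := by
  refine (RingQuot.liftAlgHom_mkAlgHom_apply ℂ _ _ (freeGen ξ i)).trans ?_
  simp [freeGen]

theorem hom_ext {A : Type*} [Ring A] [Algebra ℂ A] {f g : BoseAlgebra →ₐ[ℂ] A}
    (h : ∀ ξ i, f (gen ξ i) = g (gen ξ i)) : f = g := by
  refine RingQuot.ringQuot_ext' ℂ f g (FreeAlgebra.hom_ext ?_)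
  ext q
  exact h q.1 q.2

end BoseAlgebra

/-- The parabosonic superalgebra `P_B`; the generators `B_i^±` are odd. -/
def PB : SuperAlg where
  carrier := ParaAlgebra
  γ := ParaAlgebra.lift (fun ξ i => -ParaAlgebra.gen ξ i)
    (fun ξ η ε i j k => by rw [paraExpr_neg, ParaAlgebra.paraExpr_gen, neg_zero])
  γ_γ a := by
    refine DFunLike.congr_fun (f := AlgHom.comp _ _) (g := AlgHom.id ℂ _)
      (ParaAlgebra.hom_ext fun ξ i => ?_) a
    simp [ParaAlgebra.lift_gen]

/-- The bosonic superalgebra `B`; the generators `b_i^±` are odd. -/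
def BB : SuperAlg where
  carrier := BoseAlgebra
  γ := BoseAlgebra.lift (fun ξ i => -BoseAlgebra.gen ξ i)
    (fun i j => by simpa using BoseAlgebra.gen_ccr i j)
    (fun ξ i j => by simpa using BoseAlgebra.gen_comm ξ i j)
  γ_γ a := by
    refine DFunLike.congr_fun (f := AlgHom.comp _ _) (g := AlgHom.id ℂ _)
      (BoseAlgebra.hom_ext fun ξ i => ?_) a
    simp [BoseAlgebra.lift_gen]

/-- The generator `B_i^ξ` of `P_B`. -/
def PB.gen (ξ : ℤˣ) (i : ℕ) : PB := ParaAlgebra.gen ξ i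

theorem PB.γ_gen (ξ : ℤˣ) (i : ℕ) : PB.γ (PB.gen ξ i) = -PB.gen ξ i :=
  ParaAlgebra.lift_gen (A := ParaAlgebra) _ _ ξ i

/-- The algebra homomorphism from `P_B` determined by the images of the generators. -/
def PB.lift {A : Type*} [Ring A] [Algebra ℂ A] (x : ℤˣ → ℕ → A)
    (h : ∀ ξ η ε i j k, paraExpr x ξ η ε i j k = 0) : PB →ₐ[ℂ] A :=
  ParaAlgebra.lift x h

theorem PB.lift_gen {A : Type*} [Ring A] [Algebra ℂ A] (x : ℤˣ → ℕ → A)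
    (h : ∀ ξ η ε i j k, paraExpr x ξ η ε i j k = 0) (ξ : ℤˣ) (i : ℕ) :
    PB.lift x h (PB.gen ξ i) = x ξ i :=
  ParaAlgebra.lift_gen x h ξ i

theorem PB.hom_ext {A : Type*} [Ring A] [Algebra ℂ A] {f g : PB →ₐ[ℂ] A}
    (h : ∀ ξ i, f (PB.gen ξ i) = g (PB.gen ξ i)) : f = g :=
  ParaAlgebra.hom_ext h

/-- The generator `b_i^ξ` of `B`. -/
def BB.gen (ξ : ℤˣ) (i : ℕ) : BB := BoseAlgebra.gen ξ i

theorem BB.γ_gen (ξ : ℤˣ) (i : ℕ) : BB.γ (BB.gen ξ i) = -BB.gen ξ i :=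
  BoseAlgebra.lift_gen (A := BoseAlgebra) _ _ _ ξ i

theorem paraExpr_BB_gen (ξ η ε : ℤˣ) (i j k : ℕ) : paraExpr BB.gen ξ η ε i j k = 0 :=
  paraExpr_eq_zero_of_ccr (A := BoseAlgebra) BoseAlgebra.gen BoseAlgebra.gen_ccr
    BoseAlgebra.gen_comm ξ η ε i j k

/-- The replacement map `φ : P_B → B`, `B_i^± ↦ b_i^±`. -/
def replacement : SuperAlg.Hom PB BB where
  toAlgHom := PB.lift BB.gen paraExpr_BB_gen
  map_γ a := by
    have : (PB.lift BB.gen paraExpr_BB_gen).comp PB.γ =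
        BB.γ.comp (PB.lift BB.gen paraExpr_BB_gen) := by
      refine PB.hom_ext fun ξ i => ?_
      rw [AlgHom.comp_apply, AlgHom.comp_apply, PB.γ_gen, map_neg, PB.lift_gen, BB.γ_gen]
    exact DFunLike.congr_fun this a

/-- The images `B_i^ξ ⊗ 1 + 1 ⊗ B_i^ξ` of the generators under the super coproduct. -/
def coproductGen (ξ : ℤˣ) (i : ℕ) : PB.grading ᵍ⊗[ℂ] PB.grading :=
  PB.gen ξ i ᵍ⊗ₜ[ℂ] 1 + 1 ᵍ⊗ₜ[ℂ] PB.gen ξ i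

theorem paraExpr_coproductGen (ξ η ε : ℤˣ) (i j k : ℕ) :
    paraExpr coproductGen ξ η ε i j k = 0 := by
  have h := paraExpr_add
    (fun ξ i => GradedTensorProduct.includeLeft PB.grading PB.grading (PB.gen ξ i))
    (fun ξ i => GradedTensorProduct.includeRight PB.grading PB.grading (PB.gen ξ i))
    (fun ξ η i j => by
      have := SuperAlg.tmul_supercomm (A := PB) (B := PB) (i := 1) (j := 1)
        (SuperAlg.mem_grading_one.2 (PB.γ_gen η j)) (SuperAlg.mem_grading_one.2 (PB.γ_gen ξ i))
      rw [this]
      simp) ξ η ε i j k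
  rw [← map_paraExpr, ← map_paraExpr] at h
  have h0 : paraExpr PB.gen ξ η ε i j k = 0 := ParaAlgebra.paraExpr_gen ξ η ε i j k
  rw [h0, map_zero, map_zero, add_zero] at h
  exact h

/-- The super coproduct `Δ : P_B → P_B ⊗̲ P_B`, `Δ(B_i^±) = 1 ⊗ B_i^± + B_i^± ⊗ 1`. -/
def coproduct : SuperAlg.Hom PB (PB.tensor PB) where
  toAlgHom := PB.lift coproductGen paraExpr_coproductGen
  map_γ a := by
    have : (PB.lift coproductGen paraExpr_coproductGen).comp PB.γ =
        (SuperAlg.tensorAlgHom PB.parityHom PB.parityHom).comp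
          (PB.lift coproductGen paraExpr_coproductGen) := by
      refine PB.hom_ext fun ξ i => ?_
      rw [AlgHom.comp_apply, AlgHom.comp_apply, PB.γ_gen, map_neg, PB.lift_gen, coproductGen,
        map_add, SuperAlg.tensorAlgHom_tmul, SuperAlg.tensorAlgHom_tmul]
      simp only [SuperAlg.parityHom, PB.γ_gen, map_one, GradedTensorProduct.tmul,
        TensorProduct.neg_tmul, TensorProduct.tmul_neg, map_neg, neg_add]
    exact DFunLike.congr_fun this a

/-- The braided tensor product `P_B ⊗̲ ⋯ ⊗̲ P_B` of `n + 1` copies of `P_B`. -/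
def PBpow : ℕ → SuperAlg
  | 0 => PB
  | n + 1 => (PBpow n).tensor PB

/-- `Δ ⊗ Id ⊗ ⋯ ⊗ Id`, with `n` copies of `Id`. -/
def coproductFirst : (n : ℕ) → SuperAlg.Hom (PBpow n) (PBpow (n + 1))
  | 0 => coproduct
  | n + 1 => (coproductFirst n).tensor (SuperAlg.Hom.id PB)

/-- The iterated super coproduct `Δ^(n)`, from `P_B` to the braided tensor product of `n + 1` copies
of `P_B`: `Δ^(1) = Δ` and `Δ^(n + 1) = (Δ ⊗ Id ⊗ ⋯ ⊗ Id) ∘ Δ^(n)`. -/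
def iteratedCoproduct : (n : ℕ) → SuperAlg.Hom PB (PBpow n)
  | 0 => SuperAlg.Hom.id PB
  | n + 1 => (coproductFirst n).comp (iteratedCoproduct n)

/-! ### The Fock module -/

/-- The bosonic Fock space: the vector space with basis the number states `|k₀, k₁, …⟩` for finitely
supported sequences `k` of natural numbers. -/
abbrev FockSpace : Type := (ℕ →₀ ℕ) →₀ ℂ

/-- The number state `|k⟩`. -/
def ket (k : ℕ →₀ ℕ) : FockSpace := Finsupp.single k 1

/-- The linear map with prescribed values on the number states. -/
def onKets (f : (ℕ →₀ ℕ) → FockSpace) : FockSpace →ₗ[ℂ] FockSpace := Finsupp.linearCombination ℂ f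

theorem onKets_ket (f : (ℕ →₀ ℕ) → FockSpace) (k : ℕ →₀ ℕ) : onKets f (ket k) = f k := by
  simp [onKets, ket]

theorem ket_ext {V : Type*} [AddCommGroup V] [Module ℂ V] {f g : FockSpace →ₗ[ℂ] V}
    (h : ∀ k, f (ket k) = g (ket k)) : f = g := by
  ext k
  exact h k

/-- The creation and annihilation operators:
`b_i^+ |k⟩ = √(k_i + 1) |…, k_i + 1, …⟩` and `b_i^- |k⟩ = √k_i |…, k_i - 1, …⟩`
(the latter being `0` for `k_i = 0`). -/
def fockOp (ξ : ℤˣ) (i : ℕ) : Module.End ℂ FockSpace :=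
  if ξ = 1 then
    onKets fun k => ((Real.sqrt ((k i : ℝ) + 1) : ℝ) : ℂ) • ket (k.update i (k i + 1))
  else
    onKets fun k => ((Real.sqrt (k i : ℝ) : ℝ) : ℂ) • ket (k.update i (k i - 1))

theorem fockOp_plus (i : ℕ) (k : ℕ →₀ ℕ) :
    fockOp 1 i (ket k) = ((Real.sqrt ((k i : ℝ) + 1) : ℝ) : ℂ) • ket (k.update i (k i + 1)) := by
  simp [fockOp, onKets_ket]

theorem fockOp_minus (i : ℕ) (k : ℕ →₀ ℕ) :
    fockOp (-1) i (ket k) = ((Real.sqrt (k i : ℝ) : ℝ) : ℂ) • ket (k.update i (k i - 1)) := by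
  rw [fockOp, if_neg (by decide), onKets_ket]

theorem sqrt_mul_self_complex (x : ℝ) (hx : 0 ≤ x) :
    ((Real.sqrt x : ℝ) : ℂ) * ((Real.sqrt x : ℝ) : ℂ) = (x : ℂ) := by
  rw [← Complex.ofReal_mul, Real.mul_self_sqrt hx]

theorem update_comm {i j : ℕ} (hij : i ≠ j) (k : ℕ →₀ ℕ) (a b : ℕ) :
    (k.update i a).update j b = (k.update j b).update i a := by
  ext l
  simp only [Finsupp.coe_update, Function.update_apply]
  split_ifs <;> simp_all

theorem fockOp_comm_of_ne {i j : ℕ} (hij : i ≠ j) (ξ η : ℤˣ) :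
    fockOp ξ i * fockOp η j = fockOp η j * fockOp ξ i := by
  refine ket_ext fun k => ?_
  simp only [Module.End.mul_apply]
  obtain rfl | rfl := Int.units_eq_one_or ξ <;> obtain rfl | rfl := Int.units_eq_one_or η <;>
  · simp only [fockOp_plus, fockOp_minus, map_smul, Finsupp.coe_update,
      Function.update_of_ne hij, Function.update_of_ne hij.symm, update_comm hij, smul_smul]
    rw [mul_comm]

theorem fockOp_ccr (i j : ℕ) :
    fockOp (-1) i * fockOp 1 j - fockOp 1 j * fockOp (-1) i =
      delta i j • (1 : Module.End ℂ FockSpace) := by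
  by_cases hij : i = j
  · subst hij
    refine ket_ext fun k => ?_
    have h1 : fockOp (-1) i (fockOp 1 i (ket k)) = ((k i : ℂ) + 1) • ket k := by
      rw [fockOp_plus, map_smul, fockOp_minus, smul_smul]
      have e : (k.update i (k i + 1)).update i ((k.update i (k i + 1)) i - 1) = k := by
        ext l
        simp only [Finsupp.coe_update, Function.update_apply]
        split_ifs <;> simp_all
      have e' : (((k.update i (k i + 1)) i : ℕ) : ℝ) = (k i : ℝ) + 1 := by simp
      rw [e, e', sqrt_mul_self_complex _ (by positivity)]
      push_cast
      rfl
    have h2 : fockOp 1 i (fockOp (-1) i (ket k)) = (k i : ℂ) • ket k := by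
      rw [fockOp_minus, map_smul, fockOp_plus, smul_smul]
      rcases Nat.eq_zero_or_pos (k i) with h0 | h0
      · simp [h0]
      · have e : (k.update i (k i - 1)).update i ((k.update i (k i - 1)) i + 1) = k := by
          ext l
          simp only [Finsupp.coe_update, Function.update_apply]
          split_ifs with hl
          · rw [hl, Nat.sub_add_cancel h0]
          · rfl
        have e' : (((k.update i (k i - 1)) i : ℕ) : ℝ) + 1 = (k i : ℝ) := by
          simp [Nat.cast_sub (show 1 ≤ k i from h0)]
        rw [e, e', sqrt_mul_self_complex _ (by positivity)]
        push_cast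
        rfl
    simp only [LinearMap.sub_apply, Module.End.mul_apply, h1, h2, delta, if_true, one_smul,
      Module.End.one_apply]
    module
  · rw [delta, if_neg hij, zero_smul]
    exact sub_eq_zero.2 (fockOp_comm_of_ne hij _ _)

theorem fockOp_comm (ξ : ℤˣ) (i j : ℕ) : fockOp ξ i * fockOp ξ j - fockOp ξ j * fockOp ξ i = 0 := by
  by_cases hij : i = j
  · rw [hij]
    exact sub_eq_zero.2 (rfl : fockOp ξ j * fockOp ξ j = fockOp ξ j * fockOp ξ j)
  · exact sub_eq_zero.2 (fockOp_comm_of_ne hij _ _)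

/-- The parity operator of Fock space: `|k⟩` is even or odd according to the parity of `∑ k_i`. -/
def fockParity : FockSpace →ₗ[ℂ] FockSpace := onKets fun k => (-1 : ℂ) ^ k.degree • ket k

theorem fockParity_ket (k : ℕ →₀ ℕ) : fockParity (ket k) = (-1 : ℂ) ^ k.degree • ket k :=
  onKets_ket _ k

theorem fockParity_fockOp (ξ : ℤˣ) (i : ℕ) :
    (fockParity * fockOp ξ i : Module.End ℂ FockSpace) = -(fockOp ξ i * fockParity) := by
  have up : ∀ k : ℕ →₀ ℕ, (k.update i (k i + 1)).degree = k.degree + 1 := by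
    intro k
    have : k.update i (k i + 1) = k + Finsupp.single i 1 := by
      ext l
      simp only [Finsupp.coe_update, Function.update_apply, Finsupp.add_apply,
        Finsupp.single_apply]
      split_ifs <;> simp_all
    rw [this, map_add, Finsupp.degree_single]
  refine ket_ext fun k => ?_
  simp only [Module.End.mul_apply, LinearMap.neg_apply]
  obtain rfl | rfl := Int.units_eq_one_or ξ
  · rw [fockOp_plus, map_smul, fockParity_ket, fockParity_ket, map_smul, fockOp_plus, up, pow_succ]
    module
  · rw [fockOp_minus, map_smul, fockParity_ket, fockParity_ket, map_smul, fockOp_minus]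
    rcases Nat.eq_zero_or_pos (k i) with h0 | h0
    · simp [h0]
    · have e : (k.update i (k i - 1)).update i ((k.update i (k i - 1)) i + 1) = k := by
        ext l
        simp only [Finsupp.coe_update, Function.update_apply]
        split_ifs with hl
        · rw [hl, Nat.sub_add_cancel h0]
        · rfl
      have h := up (k.update i (k i - 1))
      rw [e] at h
      rw [h, pow_succ]
      module

/-- The action of the bosonic algebra on Fock space. -/
def fockAction : BB →ₐ[ℂ] Module.End ℂ FockSpace :=
  BoseAlgebra.lift fockOp fockOp_ccr fockOp_comm

theorem fockAction_gen (ξ : ℤˣ) (i : ℕ) : fockAction (BB.gen ξ i) = fockOp ξ i :=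
  BoseAlgebra.lift_gen _ _ _ ξ i

theorem fockParity_fockParity (v : FockSpace) : fockParity (fockParity v) = v := by
  refine DFunLike.congr_fun (f := fockParity ∘ₗ fockParity) (g := LinearMap.id)
    (ket_ext fun k => ?_) v
  simp [fockParity_ket, smul_smul, ← mul_pow]

theorem fockParity_fockAction (a : BB) (v : FockSpace) :
    fockParity (fockAction a v) = fockAction (BB.γ a) (fockParity v) := by
  have hp : fockParity * fockParity = (1 : Module.End ℂ FockSpace) :=
    LinearMap.ext fockParity_fockParity
  let conj : Module.End ℂ FockSpace →ₐ[ℂ] Module.End ℂ FockSpace :=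
    AlgHom.ofLinearMap
      ((LinearMap.mulLeft ℂ (fockParity : Module.End ℂ FockSpace)).comp
        (LinearMap.mulRight ℂ (fockParity : Module.End ℂ FockSpace)))
      (by simp [hp])
      (by
        intro x y
        simp only [LinearMap.comp_apply, LinearMap.mulLeft_apply, LinearMap.mulRight_apply]
        calc fockParity * (x * y * fockParity) = fockParity * (x * 1 * y * fockParity) := by simp
          _ = fockParity * (x * fockParity) * (fockParity * (y * fockParity)) := by
            rw [← hp]; simp only [mul_assoc])
  have h : conj.comp fockAction = fockAction.comp BB.γ := by
    refine BoseAlgebra.hom_ext (A := Module.End ℂ FockSpace) fun ξ i => ?_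
    change fockParity * (fockAction (BB.gen ξ i) * fockParity) = fockAction (BB.γ (BB.gen ξ i))
    rw [BB.γ_gen, map_neg, fockAction_gen]
    refine LinearMap.ext fun w => ?_
    have hw := DFunLike.congr_fun (fockParity_fockOp ξ i) (fockParity w)
    simp only [Module.End.mul_apply, LinearMap.neg_apply, fockParity_fockParity] at hw ⊢
    exact hw
  have h' : fockParity (fockAction a (fockParity (fockParity v))) =
      fockAction (BB.γ a) (fockParity v) :=
    congrArg (fun f : Module.End ℂ FockSpace => f (fockParity v)) (DFunLike.congr_fun h a)
  rwa [fockParity_fockParity] at h'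

/-- The bosonic Fock representation, a supermodule over `B`. -/
def boseFock : SuperMod BB where
  carrier := FockSpace
  ρ := fockAction
  γ := fockParity
  γ_γ := fockParity_fockParity
  γ_ρ := fockParity_fockAction

/-- The first Fock-like module `F(1)` of `P_B`: the bosonic Fock representation pulled back along the
replacement map. -/
def paraFock : SuperMod PB := boseFock.restrict replacement

/-- The vacuum `|0⟩` of `paraFock`. -/
def vacuum : paraFock := ket 0

/-! ### Tensor powers of the first Fock-like module -/

/-- The tensor product of `n + 1` copies of `paraFock`, as a supermodule over the braided tensor
product of `n + 1` copies of `P_B`. -/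
def fockPow : (n : ℕ) → SuperMod (PBpow n)
  | 0 => paraFock
  | n + 1 => (fockPow n).tensor paraFock

/-- The vector `|0⟩ ⊗ ⋯ ⊗ |0⟩`, with `n + 1` factors. -/
def vacuumPow : (n : ℕ) → fockPow n
  | 0 => vacuum
  | n + 1 => (vacuumPow n ⊗ₜ[ℂ] vacuum : fockPow n ⊗[ℂ] paraFock)

/-- The tensor product of `n + 1` copies of `paraFock`, as a supermodule over `P_B` through the
iterated super coproduct. -/
def tensorFock (n : ℕ) : SuperMod PB := (fockPow n).restrict (iteratedCoproduct n)

/-- The vacuum vector `|0⟩ ⊗ ⋯ ⊗ |0⟩` of `tensorFock n`. -/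
def tensorVacuum (n : ℕ) : tensorFock n := vacuumPow n

/-- The `P_B`-submodule generated by the vacuum vector. -/
def vacuumSubmodule (n : ℕ) : Submodule PB (tensorFock n) := Submodule.span PB {tensorVacuum n}

/-- The vacuum vector as an element of the submodule that it generates. -/
def submoduleVacuum (n : ℕ) : vacuumSubmodule n :=
  ⟨tensorVacuum n, Submodule.mem_span_singleton_self _⟩

/-! ### Fock-like representations -/

/-- A `P_B`-module `V` with vacuum `Ω` and inner product `ip` is the parabosonic Fock-like
representation `F(p)`: the vacuum is a unit vector, it is (up to scalars) the only vector annihilated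
by all `B_i^-`, it generates the module, `B_i^- B_j^+ Ω = p δ_ij Ω`, and `B_i^+` and `B_i^-` are
adjoint to each other. These conditions determine `F(p)` up to unitary equivalence. -/
structure IsFockLike (p : ℕ) {V : Type*} [AddCommGroup V] [Module ℂ V] [Module PB V]
    [IsScalarTower ℂ PB V] (Ω : V) (ip : InnerProductSpace.Core ℂ V) : Prop where
  inner_vacuum : ip.inner Ω Ω = 1
  annihilate : ∀ i, PB.gen (-1) i • Ω = 0
  unique_vacuum : ∀ v : V, (∀ i, PB.gen (-1) i • v = 0) → ∃ c : ℂ, v = c • Ω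
  generates : Submodule.span PB {Ω} = ⊤
  order : ∀ i j, PB.gen (-1) i • PB.gen 1 j • Ω = ((p : ℂ) * delta i j) • Ω
  adjoint : ∀ i v w, ip.inner (PB.gen (-1) i • v) w = ip.inner v (PB.gen 1 i • w)

end

noncomputable section

/-! ### The parabosonic algebra is generated by the `B_i^±` -/

/-! The engine is a length filtration on any module with a vacuum `Ω` satisfying `B_i^- Ω = 0` and
`B_i^- B_j^+ Ω = p δ_ij Ω`. The operators `{B_i^-, B_j^+}` act on `Ω` by scalars, and their
commutator with a `B_k^+` is a multiple of `B_j^+`. Hence they preserve the span of the products of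
at most `n` creation operators applied to `Ω`. It follows that `B_i^-` lowers this length, and that
the cyclic module of `Ω` is already spanned by creation products (`exists_mem_creationFiltration`).
Statements about the cyclic module can then be proved by induction on creation operators
(`span_vacuum_induction`).

This gives the abstract theory. A Fock-like module is irreducible, since a nonzero vector can be
lowered until it is a vacuum. It is unique up to isometry: adjointness and the vacuum relations
determine all inner products, so the submodule of `V × W` generated by the pair of vacua is the
graph of an isometry. In a unitary module, a unit vacuum vector of order `p` always generates a
Fock-like module (`IsFockLike.exists_of_unitary`), because a second vacuum orthogonal to the first
is orthogonal to the whole cyclic module.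

It remains to find such a vacuum in the tensor power. By the braiding sign, a generator acts on `V ⊗
F` as `x ⊗ 1 + γ ⊗ b`. Parity is self-adjoint and fixes the vacuum, so the product inner product is
again unitary and the orders add up to `1 + ⋯ + 1 = p`. For `p ≥ 2` the tensor power contains a
further vacuum vector that is not a multiple of `|0⟩ ⊗ ⋯ ⊗ |0⟩`, so the cyclic module is proper. It
is graded because its generator is even. -/

theorem PB.adjoin_gen :
    Algebra.adjoin ℂ (Set.range fun q : ℤˣ × ℕ => PB.gen q.1 q.2) = ⊤ := by
  rw [eq_top_iff]
  rintro a -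
  obtain ⟨x, rfl⟩ := RingQuot.mkAlgHom_surjective ℂ ParaRel a
  have hx : x ∈ Algebra.adjoin ℂ (Set.range (FreeAlgebra.ι ℂ : ℤˣ × ℕ → _)) := by
    rw [FreeAlgebra.adjoin_range_ι]
    trivial
  have h : RingQuot.mkAlgHom ℂ ParaRel x ∈ (Algebra.adjoin ℂ (Set.range
      (FreeAlgebra.ι ℂ : ℤˣ × ℕ → _))).map (RingQuot.mkAlgHom ℂ ParaRel) := ⟨x, hx, rfl⟩
  rw [AlgHom.map_adjoin, ← Set.range_comp] at h
  exact h

/-! ### Modules generated by a vacuum vector -/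

section Vacuum

variable {V : Type*} [AddCommGroup V] [Module ℂ V] [Module PB V] [IsScalarTower ℂ PB V]

/-- A complex subspace that is stable under all `B_i^±` is stable under `P_B`. -/
theorem smul_mem_of_gen_smul_mem (S : Submodule ℂ V)
    (h : ∀ ξ i, ∀ v ∈ S, PB.gen ξ i • v ∈ S) (a : PB) : ∀ v ∈ S, a • v ∈ S := by
  have ha : a ∈ Algebra.adjoin ℂ (Set.range fun q : ℤˣ × ℕ => PB.gen q.1 q.2) := by
    rw [PB.adjoin_gen]
    trivial
  induction ha using Algebra.adjoin_induction with
  | mem x hx =>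
    obtain ⟨q, rfl⟩ := hx
    exact h q.1 q.2
  | algebraMap r =>
    intro v hv
    rw [algebraMap_smul]
    exact S.smul_mem r hv
  | add x y _ _ hx hy =>
    intro v hv
    rw [add_smul]
    exact S.add_mem (hx v hv) (hy v hv)
  | mul x y _ _ hx hy =>
    intro v hv
    rw [mul_smul]
    exact hx _ (hy v hv)

/-- The span of the vectors `B_{i₁}^+ ⋯ B_{iₘ}^+ Ω` with `m ≤ n`. -/
def creationFiltration (Ω : V) : ℕ → Submodule ℂ V
  | 0 => Submodule.span ℂ {Ω}
  | n + 1 => creationFiltration Ω n ⊔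
      ⨆ i, (creationFiltration Ω n).map (Algebra.lsmul ℂ ℂ V (PB.gen 1 i))

variable {Ω : V}

theorem creationFiltration_succ_le {n : ℕ} {S : Submodule ℂ V}
    (h : creationFiltration Ω n ≤ S)
    (h' : ∀ i, ∀ v ∈ creationFiltration Ω n, PB.gen 1 i • v ∈ S) :
    creationFiltration Ω (n + 1) ≤ S :=
  sup_le h (iSup_le fun i => Submodule.map_le_iff_le_comap.2 (h' i))

theorem creationFiltration_mono : Monotone (creationFiltration Ω) :=
  monotone_nat_of_le_succ fun _ => le_sup_left

theorem creation_smul_mem {n : ℕ} {v : V} (hv : v ∈ creationFiltration Ω n) (i : ℕ) :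
    PB.gen 1 i • v ∈ creationFiltration Ω (n + 1) :=
  Submodule.mem_sup_right (Submodule.mem_iSup_of_mem i ⟨v, hv, rfl⟩)

/-- This is the parabosonic relation for the signs `(ξ, η, ε) = (-, +, +)`: the coefficient `ε - η`
vanishes and `ε - ξ = 2`. -/
theorem anticomm_smul_creation_smul (i j k : ℕ) (v : V) :
    (PB.gen (-1) i * PB.gen 1 j + PB.gen 1 j * PB.gen (-1) i) • PB.gen 1 k • v =
      PB.gen 1 k • (PB.gen (-1) i * PB.gen 1 j + PB.gen 1 j * PB.gen (-1) i) • v +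
        (2 * delta i k) • PB.gen 1 j • v := by
  have h : paraExpr PB.gen (-1) 1 1 i j k = 0 := ParaAlgebra.paraExpr_gen _ _ _ _ _ _
  have e : (sgn 1 - sgn (-1)) * delta i k = 2 * delta i k := by
    congr 1
    simp only [sgn]
    norm_num
  rw [paraExpr, e, sub_self, zero_mul, zero_smul, sub_zero, sub_sub, sub_eq_zero] at h
  rw [← mul_smul, h, add_smul, mul_smul, smul_assoc]

/-- The anticommutator is a scalar on the vacuum, and moving it past a creation operator costs only
a term in which that operator is replaced by another one, so lengths do not grow. -/
theorem anticomm_smul_mem {p : ℂ} (hΩ : ∀ i, PB.gen (-1) i • Ω = 0)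
    (ho : ∀ i j, PB.gen (-1) i • PB.gen 1 j • Ω = (p * delta i j) • Ω) (i j n : ℕ) :
    ∀ v ∈ creationFiltration Ω n,
      (PB.gen (-1) i * PB.gen 1 j + PB.gen 1 j * PB.gen (-1) i) • v ∈ creationFiltration Ω n := by
  induction n with
  | zero =>
    intro v hv
    obtain ⟨c, rfl⟩ := Submodule.mem_span_singleton.1 hv
    rw [smul_comm, add_smul, mul_smul, mul_smul, hΩ, smul_zero, add_zero, ho]
    exact Submodule.smul_mem _ _ (Submodule.smul_mem _ _ (Submodule.mem_span_singleton_self Ω))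
  | succ n ih =>
    -- Stability is expressed as an inclusion into a preimage, so that it need only be checked on
    -- level `n` and on its images under the `B_k^+`.
    refine creationFiltration_succ_le (S := (creationFiltration Ω (n + 1)).comap
      (Algebra.lsmul ℂ ℂ V _)) (fun v hv => creationFiltration_mono n.le_succ (ih v hv))
      fun k v hv => ?_
    change (PB.gen (-1) i * PB.gen 1 j + PB.gen 1 j * PB.gen (-1) i) • PB.gen 1 k • v ∈
      creationFiltration Ω (n + 1)
    rw [anticomm_smul_creation_smul]
    exact Submodule.add_mem _ (creation_smul_mem (ih v hv) k)
      (Submodule.smul_mem _ _ (creation_smul_mem hv j))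

theorem annihilation_smul_eq_zero (hΩ : ∀ i, PB.gen (-1) i • Ω = 0) (i : ℕ) {v : V}
    (hv : v ∈ creationFiltration Ω 0) : PB.gen (-1) i • v = 0 := by
  obtain ⟨c, rfl⟩ := Submodule.mem_span_singleton.1 hv
  rw [smul_comm, hΩ, smul_zero]

/-- Write `B_i^- B_j^+ = {B_i^-, B_j^+} - B_j^+ B_i^-`: the anticommutator preserves length, and in
the last term `B_i^-` acts on a shorter product. -/
theorem annihilation_smul_mem {p : ℂ} (hΩ : ∀ i, PB.gen (-1) i • Ω = 0)
    (ho : ∀ i j, PB.gen (-1) i • PB.gen 1 j • Ω = (p * delta i j) • Ω) (i n : ℕ) :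
    ∀ v ∈ creationFiltration Ω (n + 1), PB.gen (-1) i • v ∈ creationFiltration Ω n := by
  have key : ∀ m j, ∀ v ∈ creationFiltration Ω m,
      PB.gen 1 j • PB.gen (-1) i • v ∈ creationFiltration Ω m →
      PB.gen (-1) i • PB.gen 1 j • v ∈ creationFiltration Ω m := by
    intro m j v hv h
    have := Submodule.sub_mem _ (anticomm_smul_mem hΩ ho i j m v hv) h
    rwa [add_smul, mul_smul, mul_smul, add_sub_cancel_right] at this
  induction n with
  | zero =>
    refine creationFiltration_succ_le (S := (creationFiltration Ω 0).comap
      (Algebra.lsmul ℂ ℂ V (PB.gen (-1) i))) (fun v hv => ?_) fun j v hv => ?_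
    · change PB.gen (-1) i • v ∈ creationFiltration Ω 0
      rw [annihilation_smul_eq_zero hΩ i hv]
      exact Submodule.zero_mem _
    · refine key 0 j v hv ?_
      rw [annihilation_smul_eq_zero hΩ i hv, smul_zero]
      exact Submodule.zero_mem _
  | succ n ih =>
    exact creationFiltration_succ_le (S := (creationFiltration Ω (n + 1)).comap
      (Algebra.lsmul ℂ ℂ V (PB.gen (-1) i))) (fun v hv => creationFiltration_mono n.le_succ (ih v hv))
      fun j v hv => key (n + 1) j v hv (creation_smul_mem (ih v hv) j)

/-- The module generated by the vacuum is spanned by the vectors `B_{i₁}^+ ⋯ B_{iₘ}^+ Ω`. -/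
theorem exists_mem_creationFiltration {p : ℂ} (hΩ : ∀ i, PB.gen (-1) i • Ω = 0)
    (ho : ∀ i j, PB.gen (-1) i • PB.gen 1 j • Ω = (p * delta i j) • Ω) {v : V}
    (hv : v ∈ Submodule.span PB {Ω}) : ∃ n, v ∈ creationFiltration Ω n := by
  obtain ⟨a, rfl⟩ := Submodule.mem_span_singleton.1 hv
  -- The supremum of an increasing chain is its union; it is to be shown stable under all
  -- generators.
  have hmem : ∀ w, w ∈ ⨆ n, creationFiltration Ω n ↔ ∃ n, w ∈ creationFiltration Ω n := fun w =>
    Submodule.mem_iSup_of_directed _ creationFiltration_mono.directed_le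
  refine (hmem _).1 (smul_mem_of_gen_smul_mem (⨆ n, creationFiltration Ω n) ?_ a Ω
    ((hmem _).2 ⟨0, Submodule.mem_span_singleton_self Ω⟩))
  intro ξ i w hw
  obtain ⟨n, hn⟩ := (hmem _).1 hw
  rw [hmem]
  obtain rfl | rfl := Int.units_eq_one_or ξ
  · exact ⟨n + 1, creation_smul_mem hn i⟩
  -- Lowering is stated from level `n + 1`, so `w` is first regarded as an element of that level;
  -- this also covers `n = 0`.
  · exact ⟨n, annihilation_smul_mem hΩ ho i n w (creationFiltration_mono n.le_succ hn)⟩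

theorem creationFiltration_le_span (n : ℕ) :
    ∀ v ∈ creationFiltration Ω n, v ∈ Submodule.span PB {Ω} := by
  induction n with
  | zero =>
    intro v hv
    obtain ⟨c, rfl⟩ := Submodule.mem_span_singleton.1 hv
    exact Submodule.smul_of_tower_mem _ c (Submodule.mem_span_singleton_self Ω)
  | succ n ih =>
    exact creationFiltration_succ_le (S := (Submodule.span PB {Ω}).restrictScalars ℂ) ih
      fun i v hv => Submodule.smul_mem _ _ (ih v hv)

/-- Induction on creation operators: a complex subspace that contains the vacuum and is stable under
the action of the `B_i^+` on the module generated by the vacuum contains this module. -/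
theorem span_vacuum_induction {p : ℂ} (hΩ : ∀ i, PB.gen (-1) i • Ω = 0)
    (ho : ∀ i j, PB.gen (-1) i • PB.gen 1 j • Ω = (p * delta i j) • Ω) (S : Submodule ℂ V)
    (h0 : Ω ∈ S) (h : ∀ i, ∀ v ∈ Submodule.span PB {Ω}, v ∈ S → PB.gen 1 i • v ∈ S) :
    ∀ v ∈ Submodule.span PB {Ω}, v ∈ S := by
  intro v hv
  obtain ⟨n, hn⟩ := exists_mem_creationFiltration hΩ ho hv
  suffices creationFiltration Ω n ≤ S from this hn
  clear hn
  induction n with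
  | zero => exact (Submodule.span_singleton_le_iff_mem _ _).2 h0
  | succ n ih =>
    exact creationFiltration_succ_le ih fun i w hw =>
      h i w (creationFiltration_le_span n w hw) (ih hw)

end Vacuum

/-! ### Fock-like representations -/

namespace InnerProductSpace.Core

variable {V : Type*} [AddCommGroup V] [Module ℂ V]

/-- The linear functional `⟪v, ·⟫`. -/
def innerRight (ip : Core ℂ V) (v : V) : V →ₗ[ℂ] ℂ where
  toFun := ip.inner v
  map_add' := inner_add_right (𝕜 := ℂ) v
  map_smul' _ w := inner_smul_right (𝕜 := ℂ) v w

/-- The subspace of all pairs `(v, w)` with `⟪x.1, v⟫ = ⟪x.2, w⟫`. -/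
def equalizer {W : Type*} [AddCommGroup W] [Module ℂ W] (ip : Core ℂ V) (ip' : Core ℂ W)
    (x : V × W) : Submodule ℂ (V × W) :=
  LinearMap.eqLocus ((ip.innerRight x.1).comp (LinearMap.fst ℂ V W))
    ((ip'.innerRight x.2).comp (LinearMap.snd ℂ V W))

theorem inner_eq_symm {W : Type*} [AddCommGroup W] [Module ℂ W] {ip : Core ℂ V} {ip' : Core ℂ W}
    {v v' : V} {w w' : W} (h : ip.inner v v' = ip'.inner w w') :
    ip.inner v' v = ip'.inner w' w := by
  rw [← ip.conj_inner_symm, ← ip'.conj_inner_symm, h]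

end InnerProductSpace.Core

namespace IsFockLike

open InnerProductSpace.Core

variable {p : ℕ} {V : Type*} [AddCommGroup V] [Module ℂ V] [Module PB V] [IsScalarTower ℂ PB V]
  {Ω : V} {ip : InnerProductSpace.Core ℂ V}

theorem vacuum_ne_zero (h : IsFockLike p Ω ip) : Ω ≠ 0 := by
  rintro rfl
  exact zero_ne_one ((inner_zero_left (𝕜 := ℂ) (0 : V)).symm.trans h.inner_vacuum)

/-- Annihilation operators are applied to a nonzero vector of a submodule as long as the result can
be kept nonzero. Length bounds the number of steps, and the last vector is a nonzero multiple of the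
unique vacuum, which generates everything. -/
theorem isSimpleModule (h : IsFockLike p Ω ip) : IsSimpleModule PB V := by
  have : Nontrivial V := ⟨Ω, 0, h.vacuum_ne_zero⟩
  have hΩ : ∀ N : Submodule PB V, Ω ∈ N → N = ⊤ := fun N hN => by
    rw [eq_top_iff, ← h.generates]
    exact (Submodule.span_singleton_le_iff_mem _ _).2 hN
  refine isSimpleModule_iff .. |>.2 ⟨fun N => or_iff_not_imp_left.2 fun hN => hΩ N ?_⟩
  obtain ⟨v, hv, hv0⟩ := N.ne_bot_iff.1 hN
  obtain ⟨n, hn⟩ := exists_mem_creationFiltration h.annihilate h.order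
    (h.generates ▸ Submodule.mem_top : v ∈ Submodule.span PB {Ω})
  have of_vacuum : ∀ w ∈ N, w ≠ 0 → (∀ i, PB.gen (-1) i • w = 0) → Ω ∈ N := by
    intro w hw hw0 hB
    obtain ⟨c, rfl⟩ := h.unique_vacuum w hB
    have hc : c ≠ 0 := by rintro rfl; exact hw0 (zero_smul _ _)
    simpa [smul_smul, inv_mul_cancel₀ hc] using Submodule.smul_of_tower_mem N c⁻¹ hw
  induction n generalizing v with
  | zero => exact of_vacuum v hv hv0 fun i => annihilation_smul_eq_zero h.annihilate i hn
  | succ n ih =>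
    by_cases hB : ∀ i, PB.gen (-1) i • v = 0
    · exact of_vacuum v hv hv0 hB
    · obtain ⟨i, hi⟩ := not_forall.1 hB
      exact ih _ (N.smul_mem _ hv) hi (annihilation_smul_mem h.annihilate h.order i n v hn)

/-! ### Uniqueness: comparing two Fock-like representations -/

variable {W : Type*} [AddCommGroup W] [Module ℂ W] [Module PB W] [IsScalarTower ℂ PB W]
  {Ω' : W} {ip' : InnerProductSpace.Core ℂ W}

theorem prod_annihilate (h : IsFockLike p Ω ip) (h' : IsFockLike p Ω' ip') (i : ℕ) :
    PB.gen (-1) i • (Ω, Ω') = 0 := by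
  rw [Prod.smul_mk, h.annihilate, h'.annihilate]
  rfl

theorem prod_order (h : IsFockLike p Ω ip) (h' : IsFockLike p Ω' ip') (i j : ℕ) :
    PB.gen (-1) i • PB.gen 1 j • (Ω, Ω') = ((p : ℂ) * delta i j) • (Ω, Ω') := by
  simp only [Prod.smul_mk, h.order, h'.order]

/-- Base case of the comparison of inner products: both vacua have norm one, and each is orthogonal
to every vector of the form `B_i^+ y`. -/
theorem inner_vacuum_eq (h : IsFockLike p Ω ip) (h' : IsFockLike p Ω' ip') :
    ∀ y ∈ Submodule.span PB {(Ω, Ω')}, ip.inner Ω y.1 = ip'.inner Ω' y.2 := by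
  refine span_vacuum_induction (h.prod_annihilate h') (h.prod_order h')
    (equalizer ip ip' (Ω, Ω')) (h.inner_vacuum.trans h'.inner_vacuum.symm) fun i y _ _ => ?_
  change ip.inner Ω (PB.gen 1 i • y.1) = ip'.inner Ω' (PB.gen 1 i • y.2)
  rw [← h.adjoint, ← h'.adjoint, h.annihilate, h'.annihilate]
  exact (inner_zero_left (𝕜 := ℂ) y.1).trans (inner_zero_left (𝕜 := ℂ) y.2).symm

/-- The inner products agree on the module generated by the pair of vacua. -/
theorem inner_eq_of_mem_span (h : IsFockLike p Ω ip) (h' : IsFockLike p Ω' ip') :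
    ∀ x ∈ Submodule.span PB {(Ω, Ω')}, ∀ y ∈ Submodule.span PB {(Ω, Ω')},
      ip.inner x.1 y.1 = ip'.inner x.2 y.2 := by
  intro x hx
  have := span_vacuum_induction (h.prod_annihilate h') (h.prod_order h')
    -- The subspace of all `x` whose inner products with every `y` of the cyclic module agree;
    -- quantifying over all `y` lets the induction replace `y` by `B_i^- y`.
    (⨅ y ∈ Submodule.span PB {(Ω, Ω')}, equalizer ip ip' y) ?_ ?_ x hx
  · intro y hy
    exact inner_eq_symm ((Submodule.mem_iInf _).1 ((Submodule.mem_iInf _).1 this y) hy)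
  · simp only [Submodule.mem_iInf]
    intro y hy
    exact inner_eq_symm (h.inner_vacuum_eq h' y hy)
  · intro i v _ hv
    simp only [Submodule.mem_iInf] at hv ⊢
    intro y hy
    have := hv _ (Submodule.smul_mem _ (PB.gen (-1) i) hy)
    change ip.inner (PB.gen (-1) i • y.1) v.1 = ip'.inner (PB.gen (-1) i • y.2) v.2 at this
    rwa [h.adjoint, h'.adjoint] at this

/-- Fock-like representations with the same `p` are unitarily equivalent. -/
theorem exists_isometry (h : IsFockLike p Ω ip) (h' : IsFockLike p Ω' ip') :
    ∃ e : V ≃ₗ[PB] W, e Ω = Ω' ∧ ∀ v w, ip'.inner (e v) (e w) = ip.inner v w := by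
  have hi := h.inner_eq_of_mem_span h'
  set G := Submodule.span PB {(Ω, Ω')} with hG
  have hmem : (Ω, Ω') ∈ G := Submodule.mem_span_singleton_self _
  let f : G →ₗ[PB] V := (LinearMap.fst PB V W).comp G.subtype
  let g : G →ₗ[PB] W := (LinearMap.snd PB V W).comp G.subtype
  have hf : Function.Bijective f := by
    refine ⟨(injective_iff_map_eq_zero f).2 fun x hx => Subtype.ext ?_, ?_⟩
    · have hx' : (x : V × W).1 = 0 := hx
      refine Prod.ext hx' (ip'.definite _ ((hi x x.2 x x.2).symm.trans ?_))
      rw [hx']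
      exact inner_zero_left (𝕜 := ℂ) (0 : V)
    · rw [← LinearMap.range_eq_top, eq_top_iff, ← h.generates]
      exact (Submodule.span_singleton_le_iff_mem _ _).2 ⟨⟨_, hmem⟩, rfl⟩
  have hg : Function.Bijective g := by
    refine ⟨(injective_iff_map_eq_zero g).2 fun x hx => Subtype.ext ?_, ?_⟩
    · have hx' : (x : V × W).2 = 0 := hx
      refine Prod.ext (ip.definite _ ((hi x x.2 x x.2).trans ?_)) hx'
      rw [hx']
      exact inner_zero_left (𝕜 := ℂ) (0 : W)
    · rw [← LinearMap.range_eq_top, eq_top_iff, ← h'.generates]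
      exact (Submodule.span_singleton_le_iff_mem _ _).2 ⟨⟨_, hmem⟩, rfl⟩
  let ef := LinearEquiv.ofBijective f hf
  let eg := LinearEquiv.ofBijective g hg
  refine ⟨ef.symm.trans eg, ?_, fun v w => ?_⟩
  · have : ef.symm Ω = ⟨_, hmem⟩ := ef.symm_apply_eq.2 rfl
    rw [LinearEquiv.trans_apply, this]
    rfl
  · have := hi _ (ef.symm v).2 _ (ef.symm w).2
    exact this.symm.trans (congrArg₂ ip.inner (ef.apply_symm_apply v) (ef.apply_symm_apply w))



/-- In a unitary `P_B`-module, a unit vector `Ω` with `B_i^- Ω = 0` and `B_i^- B_j^+ Ω = p δ_ij Ω`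
generates a Fock-like representation. -/
theorem exists_of_unitary {V : Type*} [AddCommGroup V] [Module ℂ V] [Module PB V]
    [IsScalarTower ℂ PB V] (p : ℕ) (Ω : V) (ip : InnerProductSpace.Core ℂ V)
    (h1 : ip.inner Ω Ω = 1) (hΩ : ∀ i, PB.gen (-1) i • Ω = 0)
    (ho : ∀ i j, PB.gen (-1) i • PB.gen 1 j • Ω = ((p : ℂ) * delta i j) • Ω)
    (ha : ∀ i v w, ip.inner (PB.gen (-1) i • v) w = ip.inner v (PB.gen 1 i • w)) :
    ∃ ip' : InnerProductSpace.Core ℂ (Submodule.span PB {Ω}),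
      IsFockLike p (⟨Ω, Submodule.mem_span_singleton_self Ω⟩ : Submodule.span PB {Ω}) ip' := by
  refine ⟨{ inner := fun v w => ip.inner v w
            conj_inner_symm := fun v w => ip.conj_inner_symm v w
            re_inner_nonneg := fun v => ip.re_inner_nonneg v
            add_left := fun u v w => ip.add_left u v w
            smul_left := fun v w c => ip.smul_left v w c
            definite := fun v hv => Subtype.ext (ip.definite v hv) }, ?_⟩
  refine ⟨h1, fun i => Subtype.ext (hΩ i), fun v hv => ?_, ?_, fun i j => Subtype.ext (ho i j),
    fun i v w => ha i v w⟩
  -- The scalar is the coefficient of the orthogonal projection onto `Ω`. The remainder `u` is again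
  -- killed by all `B_i^-`, so it is orthogonal to `Ω` and to every `B_i^+ w`, hence to the cyclic
  -- module, and in particular to itself.
  · refine ⟨ip.inner Ω v, Subtype.ext (sub_eq_zero.1 (ip.definite _ ?_))⟩
    set u : V := (v : V) - ip.inner Ω (v : V) • Ω with hu
    have hu' : ∀ i, PB.gen (-1) i • u = 0 := fun i => by
      rw [hu, smul_sub, smul_comm, hΩ, smul_zero, sub_zero]
      exact congrArg Subtype.val (hv i)
    have hmem : u ∈ Submodule.span PB {Ω} := Submodule.sub_mem _ v.2
      (Submodule.smul_of_tower_mem _ _ (Submodule.mem_span_singleton_self Ω))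
    refine span_vacuum_induction hΩ ho (LinearMap.ker (ip.innerRight u)) ?_ ?_ u hmem
    · change ip.inner u Ω = 0
      rw [← ip.conj_inner_symm]
      have : ip.innerRight Ω u = 0 := by
        rw [hu, map_sub, map_smul]
        change ip.inner Ω (v : V) - ip.inner Ω (v : V) • ip.inner Ω Ω = 0
        rw [h1, smul_eq_mul, mul_one, sub_self]
      rw [show ip.inner Ω u = 0 from this, map_zero]
    · intro i w _ _
      change ip.inner u (PB.gen 1 i • w) = 0
      rw [← ha, hu']
      exact inner_zero_left (𝕜 := ℂ) w
  · rw [eq_top_iff]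
    rintro ⟨v, hv⟩ -
    obtain ⟨a, rfl⟩ := Submodule.mem_span_singleton.1 hv
    exact Submodule.mem_span_singleton.2 ⟨a, rfl⟩

end IsFockLike

/-! ### Unitarity of the tensor powers of Fock space -/

/-- The operators `x ξ i` are, for the inner product `ip`, mutually adjoint creation and annihilation
operators, `Ω` is an even vacuum vector of order `p`, and the parity operator `γ` is self-adjoint. -/
structure IsUnitaryVacuum (p : ℕ) {V : Type*} [AddCommGroup V] [Module ℂ V]
    (x : ℤˣ → ℕ → Module.End ℂ V) (γ : V →ₗ[ℂ] V) (Ω : V) (ip : InnerProductSpace.Core ℂ V) :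
    Prop where
  inner_vacuum : ip.inner Ω Ω = 1
  parity_vacuum : γ Ω = Ω
  parity_adjoint : ∀ v w, ip.inner (γ v) w = ip.inner v (γ w)
  annihilate : ∀ i, x (-1) i Ω = 0
  order : ∀ i j, x (-1) i (x 1 j Ω) = ((p : ℂ) * delta i j) • Ω
  adjoint : ∀ i v w, ip.inner (x (-1) i v) w = ip.inner v (x 1 i w)

/-- The operators `x ⊗ 1 + γ ⊗ y`. -/
def braidedSum {V W : Type*} [AddCommGroup V] [Module ℂ V] [AddCommGroup W] [Module ℂ W]
    (x : ℤˣ → ℕ → Module.End ℂ V) (γ : V →ₗ[ℂ] V) (y : ℤˣ → ℕ → Module.End ℂ W)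
    (ξ : ℤˣ) (i : ℕ) : Module.End ℂ (V ⊗[ℂ] W) :=
  TensorProduct.map (x ξ i) LinearMap.id + TensorProduct.map γ (y ξ i)

theorem braidedSum_tmul {V W : Type*} [AddCommGroup V] [Module ℂ V] [AddCommGroup W] [Module ℂ W]
    (x : ℤˣ → ℕ → Module.End ℂ V) (γ : V →ₗ[ℂ] V) (y : ℤˣ → ℕ → Module.End ℂ W)
    (ξ : ℤˣ) (i : ℕ) (v : V) (w : W) :
    braidedSum x γ y ξ i (v ⊗ₜ w) = x ξ i v ⊗ₜ w + γ v ⊗ₜ y ξ i w := by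
  simp [braidedSum]

theorem inner_map_adjoint {V W : Type*} [NormedAddCommGroup V] [InnerProductSpace ℂ V]
    [NormedAddCommGroup W] [InnerProductSpace ℂ W] {f f' : V →ₗ[ℂ] V} {g g' : W →ₗ[ℂ] W}
    (hf : ∀ v w, inner ℂ (f v) w = inner ℂ v (f' w))
    (hg : ∀ v w, inner ℂ (g v) w = inner ℂ v (g' w)) (v w : V ⊗[ℂ] W) :
    inner ℂ (TensorProduct.map f g v) w = inner ℂ v (TensorProduct.map f' g' w) := by
  induction v using TensorProduct.induction_on with
  | zero => simp
  | add v v' h h' => simp only [map_add, inner_add_left, h, h']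
  | tmul a b =>
    induction w using TensorProduct.induction_on with
    | zero => simp
    | add v v' h h' => simp only [map_add, inner_add_right, h, h']
    | tmul c d => simp [hf, hg]

/-- Both summands of `x ⊗ 1 + γ ⊗ y` have the expected adjoint, the second because `γ` is
self-adjoint. In `B_i^- B_j^+ (Ω ⊗ Ψ)` each mixed term contains an annihilator applied to its own
vacuum, so only the two orders survive and add. -/
theorem IsUnitaryVacuum.tensor {p q : ℕ} {V W : Type*} [AddCommGroup V] [Module ℂ V]
    [AddCommGroup W] [Module ℂ W] {x : ℤˣ → ℕ → Module.End ℂ V} {γ : V →ₗ[ℂ] V} {Ω : V}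
    {y : ℤˣ → ℕ → Module.End ℂ W} {δ : W →ₗ[ℂ] W} {Ψ : W}
    (ip : InnerProductSpace.Core ℂ V) (ip' : InnerProductSpace.Core ℂ W)
    (h : IsUnitaryVacuum p x γ Ω ip) (h' : IsUnitaryVacuum q y δ Ψ ip') :
    ∃ ip'' : InnerProductSpace.Core ℂ (V ⊗[ℂ] W),
      IsUnitaryVacuum (p + q) (braidedSum x γ y) (TensorProduct.map γ δ) (Ω ⊗ₜ Ψ) ip'' := by
  -- The cores are turned into instances to obtain the product inner product on `V ⊗ W`.
  let : NormedAddCommGroup V := ip.toNormedAddCommGroup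
  let : InnerProductSpace ℂ V := InnerProductSpace.ofCore ip.toCore
  let : NormedAddCommGroup W := ip'.toNormedAddCommGroup
  let : InnerProductSpace ℂ W := InnerProductSpace.ofCore ip'.toCore
  refine ⟨InnerProductSpace.toCore, ?_, ?_, ?_, ?_, ?_, ?_⟩
  · exact (congrArg₂ _ h.inner_vacuum h'.inner_vacuum).trans (mul_one 1)
  · rw [TensorProduct.map_tmul, h.parity_vacuum, h'.parity_vacuum]
  · exact inner_map_adjoint h.parity_adjoint h'.parity_adjoint
  · intro i
    rw [braidedSum_tmul, h.annihilate, h'.annihilate, TensorProduct.zero_tmul,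
      TensorProduct.tmul_zero, add_zero]
  · intro i j
    simp only [braidedSum_tmul, map_add, h.order, h'.order, h.annihilate, h'.annihilate,
      h.parity_vacuum, TensorProduct.zero_tmul, TensorProduct.tmul_zero, add_zero, zero_add,
      TensorProduct.tmul_smul, ← TensorProduct.smul_tmul', ← add_smul, ← add_mul, Nat.cast_add]
  · intro i v w
    have h1 := inner_map_adjoint (h.adjoint i) (g := LinearMap.id) (g' := LinearMap.id)
      (fun (v w : W) => rfl) v w
    have h2 := inner_map_adjoint h.parity_adjoint (h'.adjoint i) v w
    change inner ℂ (TensorProduct.map (x (-1) i) LinearMap.id v + TensorProduct.map γ (y (-1) i) v)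
      w = inner ℂ v (TensorProduct.map (x 1 i) LinearMap.id w + TensorProduct.map γ (y 1 i) w)
    rw [inner_add_left, inner_add_right, h1, h2]

/-- The inner product of Fock space for which the number states are orthonormal. -/
@[reducible]
def fockInner : InnerProductSpace.Core ℂ FockSpace where
  inner f g := f.sum fun k c => starRingEnd ℂ c * g k
  conj_inner_symm f g := by
    classical
    rw [Finsupp.sum_of_support_subset g (Finset.subset_union_right (s₁ := f.support)) _ (by simp),
      Finsupp.sum_of_support_subset f (Finset.subset_union_left (s₂ := g.support)) _ (by simp),
      map_sum]
    simp [mul_comm]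
  re_inner_nonneg f := by
    rw [Finsupp.sum, map_sum]
    refine Finset.sum_nonneg fun k _ => ?_
    rw [← Complex.normSq_eq_conj_mul_self]
    exact Complex.normSq_nonneg _
  add_left f g h := Finsupp.sum_add_index' (by simp) (by simp [add_mul])
  smul_left f g r := by
    rw [Finsupp.sum_smul_index (by simp), Finsupp.mul_sum]
    simp [mul_assoc]
  definite f hf := by
    have : ((∑ k ∈ f.support, Complex.normSq (f k) : ℝ) : ℂ) = 0 := by
      rw [← hf, Finsupp.sum, Complex.ofReal_sum]
      exact Finset.sum_congr rfl fun k _ => Complex.normSq_eq_conj_mul_self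
    rw [Complex.ofReal_eq_zero, Finset.sum_eq_zero_iff_of_nonneg fun _ _ => Complex.normSq_nonneg _]
      at this
    ext k
    by_cases hk : k ∈ f.support
    · exact Complex.normSq_eq_zero.1 (this k hk)
    · exact Finsupp.notMem_support_iff.1 hk

theorem fockInner_ket (k : ℕ →₀ ℕ) (g : FockSpace) : fockInner.inner (ket k) g = g k := by
  change (Finsupp.single k (1 : ℂ)).sum _ = _
  rw [Finsupp.sum_single_index (by simp), map_one, one_mul]

/-- Operators that are adjoint on number states are adjoint. -/
theorem fockInner_adjoint {f g : FockSpace →ₗ[ℂ] FockSpace}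
    (h : ∀ k l, fockInner.inner (f (ket k)) (ket l) = fockInner.inner (ket k) (g (ket l)))
    (v w : FockSpace) : fockInner.inner (f v) w = fockInner.inner v (g w) := by
  have h1 : ∀ k, (fockInner.innerRight (f (ket k))) =
      (fockInner.innerRight (ket k)).comp g := fun k => ket_ext (h k)
  induction v using Finsupp.induction_linear with
  | zero =>
    let : InnerProductSpace.Core ℂ FockSpace := fockInner
    rw [map_zero]
    exact (InnerProductSpace.Core.inner_zero_left (𝕜 := ℂ) w).trans
      (InnerProductSpace.Core.inner_zero_left (𝕜 := ℂ) (g w)).symm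
  | add v v' hv hv' => rw [map_add, fockInner.add_left, fockInner.add_left, hv, hv']
  | single k c =>
    have e : Finsupp.single k c = c • ket k := by simp [ket]
    rw [e, map_smul, fockInner.smul_left, fockInner.smul_left]
    exact congrArg _ (DFunLike.congr_fun (h1 k) w)

theorem isUnitaryVacuum_fock : IsUnitaryVacuum 1 fockOp fockParity (ket 0) fockInner where
  inner_vacuum := by rw [fockInner_ket]; simp [ket]
  parity_vacuum := by simp [fockParity_ket]
  parity_adjoint := fockInner_adjoint fun k l => by
    rw [fockParity_ket, fockParity_ket, fockInner.smul_left, fockInner_ket, fockInner_ket]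
    by_cases h : l = k
    · simp [h]
    · simp [ket, h]
  annihilate i := by simp [fockOp_minus]
  order i j := by
    have h := DFunLike.congr_fun (fockOp_ccr i j) (ket 0)
    simpa [fockOp_minus i 0] using h
  adjoint i := fockInner_adjoint fun k l => by
    rw [fockOp_plus, fockOp_minus, fockInner.smul_left, fockInner_ket, fockInner_ket]
    simp only [ket, Finsupp.smul_apply, Finsupp.single_apply, Complex.conj_ofReal, smul_eq_mul]
    -- For `k i = 0` the truncated subtraction leaves `k` unchanged, and the vanishing factor `√0`
    -- is what matters. Otherwise `l` is `k` lowered at `i` exactly when `k` is `l` raised at `i`.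
    rcases Nat.eq_zero_or_pos (k i) with h0 | h0
    · have : l.update i (l i + 1) ≠ k := by
        rintro rfl
        simp at h0
      simp [h0, this]
    · by_cases h : l = k.update i (k i - 1)
      · have h' : l.update i (l i + 1) = k := by
          ext m
          subst h
          simp only [Finsupp.coe_update, Function.update_apply]
          split_ifs with hm
          · subst hm; omega
          · rfl
        have h2 : k i = l i + 1 := by rw [← h']; simp
        rw [if_pos h, if_pos h', h2]
        simp
      · have h' : l.update i (l i + 1) ≠ k := by
          rintro rfl
          apply h
          ext m
          simp only [Finsupp.coe_update, Function.update_apply]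
          split_ifs with hm
          · subst hm; simp
          · rfl
        rw [if_neg h, if_neg h']
        simp

/-! ### The iterated coproduct on generators -/

/-- The iterated coproduct is defined by splitting the first factor. On generators it equally splits
off the last one, which matches the recursion for the tensor powers and permits induction on the
number of factors. -/
theorem iteratedCoproduct_succ_gen (n : ℕ) (ξ : ℤˣ) (i : ℕ) :
    ((iteratedCoproduct (n + 1)).toAlgHom (PB.gen ξ i) : (PBpow n).grading ᵍ⊗[ℂ] PB.grading) =
      GradedTensorProduct.includeLeft (PBpow n).grading PB.grading
          ((iteratedCoproduct n).toAlgHom (PB.gen ξ i)) +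
        GradedTensorProduct.includeRight (PBpow n).grading PB.grading (PB.gen ξ i) := by
  induction n with
  | zero => exact PB.lift_gen coproductGen paraExpr_coproductGen ξ i
  | succ n ih =>
    have : (iteratedCoproduct (n + 2)).toAlgHom (PB.gen ξ i) =
      SuperAlg.tensorAlgHom (coproductFirst n) (SuperAlg.Hom.id PB)
        ((iteratedCoproduct (n + 1)).toAlgHom (PB.gen ξ i)) := rfl
    rw [this]
    conv_lhs => rw [ih, map_add]
    refine (congrArg₂ _ (SuperAlg.tensorAlgHom_tmul (coproductFirst n) (SuperAlg.Hom.id PB) _ _)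
      (SuperAlg.tensorAlgHom_tmul (coproductFirst n) (SuperAlg.Hom.id PB) _ _)).trans ?_
    rw [map_one, map_one]
    rfl

theorem tensorFock_zero_ρ_gen (ξ : ℤˣ) (i : ℕ) :
    (tensorFock 0).ρ (PB.gen ξ i) = fockOp ξ i := by
  change fockAction (replacement.toAlgHom (PB.gen ξ i)) = fockOp ξ i
  rw [← fockAction_gen]
  exact congrArg fockAction (PB.lift_gen BB.gen paraExpr_BB_gen ξ i)

/-- Moving an odd `b` past `v` produces the sign `(-1)^|v|`, which is the parity operator on the
left factor. -/
theorem SuperMod.tensorAction_odd {A B : SuperAlg} (V : SuperMod A) (W : SuperMod B) (a : A)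
    {b : B} (hb : B.γ b = -b) (v : V) (w : W) :
    tensorAction V W (GradedTensorProduct.includeLeft A.grading B.grading a +
      GradedTensorProduct.includeRight A.grading B.grading b) (v ⊗ₜ w) =
        V.ρ a v ⊗ₜ w + V.γ v ⊗ₜ W.ρ b w := by
  rw [map_add, LinearMap.add_apply, GradedTensorProduct.includeLeft_apply,
    GradedTensorProduct.includeRight_apply, tensorAction_tmul, tensorAction_tmul]
  simp only [map_one, hb, map_neg, Module.End.one_apply, LinearMap.neg_apply,
    TensorProduct.tmul_neg, ← TensorProduct.neg_tmul, ← TensorProduct.add_tmul, ← map_add,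
    evenProj_add_oddProj]
  -- The even part of `v` minus its odd part is `γ v`.
  congr 2
  simp only [evenProj, oddProj, LinearMap.smul_apply, LinearMap.add_apply,
    LinearMap.sub_apply, LinearMap.id_apply]
  module

theorem tensorFock_succ_ρ_gen (n : ℕ) :
    (fun ξ i => (tensorFock (n + 1)).ρ (PB.gen ξ i)) =
      braidedSum (fun ξ i => (tensorFock n).ρ (PB.gen ξ i)) (tensorFock n).γ fockOp := by
  funext ξ i
  have : (tensorFock (n + 1)).ρ (PB.gen ξ i) =
    SuperMod.tensorAction (fockPow n) paraFock
      ((iteratedCoproduct (n + 1)).toAlgHom (PB.gen ξ i)) := rfl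
  rw [this, iteratedCoproduct_succ_gen]
  refine TensorProduct.ext' fun v w => ?_
  refine (SuperMod.tensorAction_odd _ _ _ (PB.γ_gen ξ i) v w).trans
    (.trans ?_ (braidedSum_tmul _ _ _ ξ i v w).symm)
  rw [← tensorFock_zero_ρ_gen]
  rfl

theorem exists_isUnitaryVacuum (n : ℕ) : ∃ ip : InnerProductSpace.Core ℂ (tensorFock n),
    IsUnitaryVacuum (n + 1) (fun ξ i => (tensorFock n).ρ (PB.gen ξ i)) (tensorFock n).γ
      (tensorVacuum n) ip := by
  induction n with
  | zero =>
    refine ⟨fockInner, ?_⟩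
    have : (fun ξ i => (tensorFock 0).ρ (PB.gen ξ i)) = fockOp :=
      funext fun ξ => funext fun i => tensorFock_zero_ρ_gen ξ i
    rw [this]
    exact isUnitaryVacuum_fock
  | succ n ih =>
    obtain ⟨ip, h⟩ := ih
    rw [tensorFock_succ_ρ_gen]
    exact IsUnitaryVacuum.tensor ip fockInner h isUnitaryVacuum_fock

/-! ### The vacuum submodule and reducibility -/

theorem exists_isFockLike (n : ℕ) : ∃ ip : InnerProductSpace.Core ℂ (vacuumSubmodule n),
    IsFockLike (n + 1) (submoduleVacuum n) ip := by
  obtain ⟨ip, h⟩ := exists_isUnitaryVacuum n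
  exact IsFockLike.exists_of_unitary (n + 1) (tensorVacuum n) ip h.inner_vacuum h.annihilate
    h.order h.adjoint

/-- The vacuum does not generate the tensor product if there are at least two factors: the vector
`B_0^+ Ω ⊗ |0⟩ - (n + 1) Ω ⊗ b_0^+ |0⟩` is annihilated by all `B_i^-`. -/
theorem vacuumSubmodule_succ_ne_top (n : ℕ) : vacuumSubmodule (n + 1) ≠ ⊤ := by
  intro htop
  obtain ⟨ip, h⟩ := exists_isFockLike (n + 1)
  obtain ⟨ip₀, h₀⟩ := exists_isUnitaryVacuum n
  have h₁ := isUnitaryVacuum_fock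
  set x : ℤˣ → ℕ → Module.End ℂ (tensorFock n) := fun ξ i => (tensorFock n).ρ (PB.gen ξ i) with hx
  -- The lowering operator with index `i` sends `B_0^+ Ω ⊗ |0⟩` to `(n + 1) δ_i0 Ω ⊗ |0⟩` and `Ω ⊗
  -- b_0^+ |0⟩` to `δ_i0 Ω ⊗ |0⟩`; the coefficient `n + 1` makes these cancel.
  let v : tensorFock n ⊗[ℂ] FockSpace := x 1 0 (tensorVacuum n) ⊗ₜ ket 0 -
    ((n + 1 : ℕ) : ℂ) • tensorVacuum n ⊗ₜ fockOp 1 0 (ket 0)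
  have hv : ∀ i, braidedSum x (tensorFock n).γ fockOp (-1) i v = 0 := by
    intro i
    simp only [v, map_sub, map_smul, braidedSum_tmul, h₀.order, h₁.order, h₀.annihilate,
      h₁.annihilate, h₀.parity_vacuum, TensorProduct.zero_tmul, TensorProduct.tmul_zero, add_zero,
      zero_add, TensorProduct.tmul_smul, ← TensorProduct.smul_tmul', smul_smul, Nat.cast_one, one_mul,
      sub_self]
  obtain ⟨c, hc⟩ := h.unique_vacuum ⟨v, htop ▸ Submodule.mem_top⟩ fun i => Subtype.ext (by
    have := hv i
    rw [hx, ← tensorFock_succ_ρ_gen] at this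
    exact this)
  have hc' : v = c • (tensorVacuum n ⊗ₜ[ℂ] ket 0) := congrArg Subtype.val hc
  -- Taking the coefficient of `|1, 0, 0, …⟩` in the last factor kills `Ω ⊗ |0⟩` and the first term
  -- of `v`, and leaves `-(n + 1) Ω = 0`, a contradiction.
  have := congrArg (TensorProduct.map LinearMap.id (Finsupp.lapply (Finsupp.single 0 1))) hc'
  replace := congrArg (TensorProduct.rid ℂ (tensorFock n)) this
  have e : fockOp 1 0 (ket 0) (Finsupp.single 0 1) = 1 := by
    have : (0 : ℕ →₀ ℕ).update 0 1 = Finsupp.single 0 1 := rfl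
    rw [fockOp_plus]
    simp [this, ket]
  have e' : ket 0 (Finsupp.single 0 1) = 0 := by simp [ket]
  simp only [v, map_sub, map_smul, TensorProduct.map_tmul, Finsupp.lapply_apply, e, e',
    TensorProduct.rid_tmul, zero_smul, one_smul, zero_sub, smul_zero, LinearMap.id_apply,
    neg_eq_zero] at this
  have hΩ : tensorVacuum n ≠ 0 := by
    intro h0
    have := h₀.inner_vacuum
    rw [h0] at this
    exact zero_ne_one ((InnerProductSpace.Core.inner_zero_left (𝕜 := ℂ) _).symm.trans this)
  exact (smul_ne_zero (Nat.cast_ne_zero.2 n.succ_ne_zero) hΩ) this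

/-! ### Gradings -/

theorem SuperMod.smul_mem_grading {A : SuperAlg} (V : SuperMod A) (i j : ZMod 2) (a : A) (v : V)
    (ha : a ∈ A.grading i) (hv : v ∈ V.grading j) : a • v ∈ V.grading (i + j) := by
  have cases2 : ∀ k : ZMod 2, k = 0 ∨ k = 1 := by decide
  rw [SuperMod.smul_def]
  obtain rfl | rfl := cases2 i <;> obtain rfl | rfl := cases2 j
  · exact mem_parityPart_zero.2 (by
      rw [V.γ_ρ, SuperAlg.mem_grading_zero.1 ha, mem_parityPart_zero.1 hv])
  · exact mem_parityPart_one.2 (by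
      rw [V.γ_ρ, SuperAlg.mem_grading_zero.1 ha, mem_parityPart_one.1 hv, map_neg])
  · exact mem_parityPart_one.2 (by
      rw [V.γ_ρ, SuperAlg.mem_grading_one.1 ha, mem_parityPart_zero.1 hv, map_neg,
        LinearMap.neg_apply])
  · exact mem_parityPart_zero.2 (by
      rw [V.γ_ρ, SuperAlg.mem_grading_one.1 ha, mem_parityPart_one.1 hv, map_neg, map_neg,
        LinearMap.neg_apply, neg_neg])

/-- A submodule that is stable under the parity operator is graded. -/
theorem SuperMod.isGradedSubmodule_of_parity {A : SuperAlg} (V : SuperMod A) (N : Submodule A V)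
    (h : ∀ v ∈ N, V.γ v ∈ N) : V.IsGradedSubmodule N := by
  intro v hv
  refine ⟨evenProj V.γ v, Submodule.smul_of_tower_mem _ _ (N.add_mem hv (h v hv)),
    oddProj V.γ v, Submodule.smul_of_tower_mem _ _ (N.sub_mem hv (h v hv)),
    mem_parityPart_zero.2 ?_, mem_parityPart_one.2 ?_, (evenProj_add_oddProj V.γ v).symm⟩
  · simp [evenProj, V.γ_γ, add_comm]
  · simp [oddProj, V.γ_γ, ← smul_neg]

theorem vacuumSubmodule_isGradedSubmodule (n : ℕ) :
    (tensorFock n).IsGradedSubmodule (vacuumSubmodule n) := by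
  refine SuperMod.isGradedSubmodule_of_parity _ _ fun v hv => ?_
  obtain ⟨ip, h⟩ := exists_isUnitaryVacuum n
  obtain ⟨a, rfl⟩ := Submodule.mem_span_singleton.1 hv
  -- Since the vacuum is even, parity sends `a Ω` to `γ(a) Ω`.
  rw [SuperMod.smul_def, (tensorFock n).γ_ρ, h.parity_vacuum]
  exact Submodule.mem_span_singleton.2 ⟨PB.γ a, rfl⟩

end

/-- Here `p = n + 1 ≥ 1` is the number of tensor factors. -/
theorem mainTheorem5 (p n : ℕ) (hp : p = n + 1) :
    -- the tensor product is a `ℤ₂`-graded `P_B`-module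
    (DirectSum.IsInternal (tensorFock n).grading ∧
      ∀ (i j : ZMod 2) (a : PB) (v : tensorFock n), a ∈ PB.grading i →
        v ∈ (tensorFock n).grading j → a • v ∈ (tensorFock n).grading (i + j)) ∧
    -- it is reducible as soon as there are at least two factors
    (2 ≤ p → ∃ N : Submodule PB (tensorFock n),
      (tensorFock n).IsGradedSubmodule N ∧ N ≠ ⊥ ∧ N ≠ ⊤) ∧
    -- the submodule generated by the vacuum is graded and irreducible
    (tensorFock n).IsGradedSubmodule (vacuumSubmodule n) ∧
    IsSimpleModule PB (vacuumSubmodule n) ∧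
    -- and it is the Fock-like representation `F(p)`, which is unique up to unitary equivalence
    ∃ ip : InnerProductSpace.Core ℂ (vacuumSubmodule n),
      IsFockLike p (submoduleVacuum n) ip ∧
      ∀ (V : Type*) [AddCommGroup V] [Module ℂ V] [Module PB V] [IsScalarTower ℂ PB V]
        (Ω : V) (ip' : InnerProductSpace.Core ℂ V), IsFockLike p Ω ip' →
        ∃ e : vacuumSubmodule n ≃ₗ[PB] V, e (submoduleVacuum n) = Ω ∧
          ∀ v w, ip'.inner (e v) (e w) = ip.inner v w := by
  subst hp
  obtain ⟨ip, h⟩ := exists_isFockLike n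
  refine ⟨⟨parityPart_isInternal _ (tensorFock n).γ_γ, (tensorFock n).smul_mem_grading⟩,
    fun hn => ⟨vacuumSubmodule n, vacuumSubmodule_isGradedSubmodule n, fun h0 => ?_, ?_⟩,
    vacuumSubmodule_isGradedSubmodule n, h.isSimpleModule, ip, h, ?_⟩
  · exact h.vacuum_ne_zero (Subtype.ext ((Submodule.eq_bot_iff _).1 h0 _ (submoduleVacuum n).2))
  -- At least two factors means `n ≥ 1`, so a last factor can be split off a nonempty tensor power.
  · obtain ⟨m, rfl⟩ := Nat.exists_eq_succ_of_ne_zero (show n ≠ 0 by omega)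
    exact vacuumSubmodule_succ_ne_top m
  · intro V _ _ _ _ Ω ip' h'
    exact h.exists_isometry h'
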